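/- Let $\mathbb D$ be the open unit disk in $\mathbb C$, $\mathbb T$ its boundary, $H(\mathbb D)$ the set of analytic functions on $\mathbb D$, and $dA=\frac1\pi\,dx\,dy$. Fix an aperture $\zeta>\frac12$ and, for $\eta\in\mathbb T$, let $\Gamma(\eta)=\{z\in\mathbb D:|z-\eta|<\zeta(1-|z|^2)\}$. Let $S(0)=\mathbb D$ and, for $0<r<1$ and $\theta\in\mathbb R$, let $S(re^{i\theta})=\{\lambda e^{it}\in\mathbb D:|t-\theta|\le\frac{1-r}2,\ 1-\lambda\le 1-r\}$. For $0<p<\infty$ and $\alpha>-2$, let $AT_p^\infty(\alpha)$ be the set of all $f\in H(\mathbb D)$ with $$\|f\|_{AT_p^\infty(\alpha)}=\operatorname*{ess\,sup}_{\eta\in\mathbb T}\left(\sup_{u\in\Gamma(\eta)}\frac1{1-|u|^2}\int_{S(u)}|f(z)|^p(1-|z|^2)^{\alpha+1}\,dA(z)\right)^{1/p}<\infty .$$ For $g\in H(\mathbb D)$ and integers $0\le k<n$, let $T_g^{n,k}f=I^n\big(f^{(k)}g^{(n-k)}\big)$ for $f\in H(\mathbb D)$, where $I^n$ is the $n$-th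 iterate of the operator $Ih(z)=\int_0^z h(w)\,dw$. **Theorem.** Let $0<p\le q<\infty$, $\alpha,\beta>-2$, $g\in H(\mathbb D)$, and let $0\le k<n$ be integers. Then $T_g^{n,k}:AT_p^\infty(\alpha)\to AT_q^\infty(\beta)$ is bounded (that is, it maps $AT_p^\infty(\alpha)$ into $AT_q^\infty(\beta)$ and there is a finite constant $C$ with $\|T_g^{n,k}f\|_{AT_q^\infty(\beta)}\le C\|f\|_{AT_p^\infty(\alpha)}$ for all $f\in AT_p^\infty(\alpha)$) if and only if $$\sup_{z\in\mathbb D}|g^{(n-k)}(z)|\,(1-|z|^2)^{\,n-k+\frac{\beta+2}q-\frac{\alpha+2}p}<\infty .$$ -/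

import Mathlib

open MeasureTheory

noncomputable section

namespace AnalyticTent

/-- The open unit disk of the complex plane. -/
def unitDisk : Set ℂ := Metric.ball (0 : ℂ) 1

/-- The set `H(𝔻)` of functions that are analytic in the unit disk. Functions are total functions
on `ℂ`; only their values on the disk are ever used. -/
def holo : Set (ℂ → ℂ) := {f | DifferentiableOn ℂ f unitDisk}

/-- The area measure `dA = (1/π) dx dy`, which gives the unit disk mass one. -/
def areaMeasure : Measure ℂ := (ENNReal.ofReal Real.pi)⁻¹ • (volume : Measure ℂ)

/-- The non-tangential region `Γ_ζ(η) = {z ∈ 𝔻 : |z - η| < ζ (1 - |z|²)}`. -/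
def nonTangential (ζ : ℝ) (η : ℂ) : Set ℂ :=
  {z | z ∈ unitDisk ∧ ‖z - η‖ < ζ * (1 - ‖z‖ ^ 2)}

open Classical in
/-- The Carleson box `S(u)`: the whole disk for `u = 0`, and
`S(r e^{iθ}) = {λ e^{it} ∈ 𝔻 : |t - θ| ≤ (1 - r) / 2, 1 - λ ≤ 1 - r}` otherwise. -/
def carlesonBox (u : ℂ) : Set ℂ :=
  if u = 0 then unitDisk
  else {z | z ∈ unitDisk ∧ ∃ l t : ℝ, z = (l : ℂ) * Complex.exp (t * Complex.I) ∧
    |t - Complex.arg u| ≤ (1 - ‖u‖) / 2 ∧ 1 - l ≤ 1 - ‖u‖}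

/-- The quasinorm of `T_p^∞(α)`, with values in `[0, ∞]`,
`esssup_{η ∈ 𝕋} (sup_{u ∈ Γ_ζ(η)} (1 - |u|²)⁻¹ ∫_{S(u)} |f|^p (1 - |z|²)^{α+1} dA)^{1/p}`.
The circle is parametrized by `η = e^{iθ}`, `θ ∈ (-π, π]`, with arc length `dθ`. -/
def tentNorm (ζ p α : ℝ) (f : ℂ → ℂ) : ENNReal :=
  essSup
    (fun θ : ℝ =>
      (⨆ u ∈ nonTangential ζ (Complex.exp (θ * Complex.I)),
        ENNReal.ofReal (1 / (1 - ‖u‖ ^ 2)) *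
          ∫⁻ z in carlesonBox u,
            ‖f z‖ₑ ^ p * ENNReal.ofReal ((1 - ‖z‖ ^ 2) ^ (α + 1)) ∂areaMeasure) ^ (1 / p))
    (volume.restrict (Set.Ioc (-Real.pi) Real.pi))

/-- The tent space `T_p^∞(α)` of measurable functions on the disk. -/
def tentSpace (ζ p α : ℝ) : Set (ℂ → ℂ) :=
  {f | Measurable (fun z : unitDisk => f z) ∧ tentNorm ζ p α f < ⊤}

/-- The analytic tent space `AT_p^∞(α) = T_p^∞(α) ∩ H(𝔻)`. -/
def analyticTentSpace (ζ p α : ℝ) : Set (ℂ → ℂ) := tentSpace ζ p α ∩ holo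

/-- The integration operator `I h (z) = ∫_0^z h(w) dw`, along the segment `w = s z`,
`0 ≤ s ≤ 1`. -/
def integrationOp (h : ℂ → ℂ) (z : ℂ) : ℂ := ∫ s in (0 : ℝ)..1, h ((s : ℂ) * z) * z

/-- The generalized integration operator `T_g^{n,k} f = I^n (f^{(k)} g^{(n-k)})`. -/
def genIntegrationOp (g : ℂ → ℂ) (n k : ℕ) (f : ℂ → ℂ) : ℂ → ℂ :=
  integrationOp^[n] (fun z => iteratedDeriv k f z * iteratedDeriv (n - k) g z)

/-- `T` maps `AT_p^∞(α)` into `AT_q^∞(β)` and is bounded, i.e. there is a finite constant `C`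
with `‖T f‖ ≤ C ‖f‖` for all `f`. -/
def IsBoundedOp (ζ p α q β : ℝ) (T : (ℂ → ℂ) → ℂ → ℂ) : Prop :=
  (∀ f ∈ analyticTentSpace ζ p α, T f ∈ analyticTentSpace ζ q β) ∧
    ∃ C : NNReal, ∀ f ∈ analyticTentSpace ζ p α,
      tentNorm ζ q β (T f) ≤ C * tentNorm ζ p α f

end AnalyticTent

end

noncomputable section

namespace AnalyticTent

open Set Metric

/-! The proof replaces the tent norm by a Carleson condition. For holomorphic `f`, finiteness of the
norm means that the integral of `|f|^p (1 - |z|)^(α+1)` over a ball of radius `δ` centred on the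
circle is at most `C δ`, with `C` comparable to the `p`-th power of the norm
(`CarlesonBound.tentNorm_le`, `carlesonBound_of_tentNorm`). Aperture, essential supremum and boxes
then disappear.

Sufficiency follows the bound through the operator. Taking `k` derivatives adds `k * p` to the
weight exponent (`CarlesonBound.iteratedDeriv`). Multiplying by `g^(n-k)` passes from `p` to `q`:
the surplus power `|f^(k)|^(q-p)` is absorbed by the pointwise growth that a Carleson bound forces
(`CarlesonBound.mul`). Then `n` integrations remove `n * q` from the exponent
(`CarlesonBound.iterate_integrationOp`). The hypothesis on `g` is exactly what makes the exponents
end at `β + 1`.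

Necessity tests the operator on normalised powers of `1 / (1 - conj a z)`, whose norms are bounded
uniformly in `a` (`carlesonBound_testFunction`). The `n`-th derivative undoes `I^n`, so at `a` it
equals `f^(k)(a) g^(n-k)(a)`; the pointwise bound on this derivative and a lower bound for
`f^(k)(a)` give the growth of `g^(n-k)`. -/

lemma mem_unitDisk {z : ℂ} : z ∈ unitDisk ↔ ‖z‖ < 1 := by simp [unitDisk]

lemma isOpen_unitDisk : IsOpen unitDisk := isOpen_ball

lemma rpow_le_of_comparable (a : ℝ) {x y c : ℝ} (hx : 0 < x) (hy : 0 < y) (hc : 1 ≤ c)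
    (hxy : x ≤ c * y) (hyx : y ≤ c * x) : x ^ a ≤ c ^ |a| * y ^ a := by
  have hc0 : 0 < c := by linarith
  rcases le_total 0 a with ha | ha
  · rw [abs_of_nonneg ha, ← Real.mul_rpow hc0.le hy.le]
    exact Real.rpow_le_rpow hx.le hxy ha
  · rw [abs_of_nonpos ha, Real.rpow_neg hc0.le, ← Real.inv_rpow hc0.le,
      ← Real.mul_rpow (by positivity) hy.le]
    refine Real.rpow_le_rpow_of_nonpos (by positivity) ?_ ha
    rw [inv_mul_le_iff₀ hc0]
    exact hyx

/-! ### Local estimates for `|f|^p` and `|f'|^p` by area averages -/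

/-- A sub-mean-value property of `|f|^p` for holomorphic `f`, valid for every `p > 0`. -/
lemma rpow_norm_le_lintegral {p : ℝ} (hp : 0 < p) : ∃ K : ℝ, 0 < K ∧ ∀ (f : ℂ → ℂ) (z : ℂ) (ρ : ℝ),
    0 < ρ → DifferentiableOn ℂ f (closedBall z ρ) →
    ENNReal.ofReal (‖f z‖ ^ p * ρ ^ 2) ≤
      ENNReal.ofReal K * ∫⁻ w in ball z ρ, ENNReal.ofReal (‖f w‖ ^ p) := by
  set l : ℝ := (4 : ℝ) ^ (1 / p) with hl
  have hlpos : 0 < l := by positivity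
  have hlp : l ^ p = 4 := by
    rw [hl, ← Real.rpow_mul (by norm_num)]; field_simp; norm_num
  -- Chosen so that the Schwarz bound below lets `f` vary by at most half of `‖f w₀‖` on the ball of
  -- radius `c * d`.
  set c : ℝ := 1 / (4 * (l + 2)) with hc
  have hcpos : 0 < c := by positivity
  have hc2 : c < 1 / 2 := by
    rw [hc, div_lt_div_iff₀ (by positivity) (by norm_num)]; linarith
  refine ⟨2 ^ p / (Real.pi * c ^ 2), by positivity, fun f z ρ hρ hf => ?_⟩
  -- Maximising this weighted quantity replaces subharmonicity of `|f|^p`. Around a maximiser `w₀`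
  -- at depth `d`, points within `d / 2` still have depth at least `d / 2`, hence `|f|^p ≤ 4 |f
  -- w₀|^p` there. The Schwarz lemma then keeps `|f|` above `|f w₀| / 2` on a smaller ball, whose
  -- area is comparable to `d ^ 2`.
  have hcont : ContinuousOn (fun w => ‖f w‖ ^ p * (ρ - ‖w - z‖) ^ 2) (closedBall z ρ) := by
    refine ContinuousOn.mul (hf.continuousOn.norm.rpow_const fun _ _ => Or.inr hp.le) ?_
    fun_prop
  obtain ⟨w₀, hw₀, hmax⟩ := (isCompact_closedBall z ρ).exists_isMaxOn ⟨z, by simp [hρ.le]⟩ hcont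
  have hz : ‖f z‖ ^ p * ρ ^ 2 ≤ ‖f w₀‖ ^ p * (ρ - ‖w₀ - z‖) ^ 2 := by
    simpa using hmax (mem_closedBall_self hρ.le)
  set d := ρ - ‖w₀ - z‖ with hd
  have hd0 : 0 ≤ d := by simpa [hd, dist_eq_norm] using hw₀
  rcases eq_or_lt_of_le (by positivity : 0 ≤ ‖f w₀‖ ^ p * d ^ 2) with h0 | h0
  · rw [ENNReal.ofReal_of_nonpos (by linarith)]; exact zero_le
  have hdpos : 0 < d := lt_of_le_of_ne hd0 (by rintro h; simp [← h] at h0)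
  have hfpos : 0 < ‖f w₀‖ := lt_of_le_of_ne (norm_nonneg _)
    (by rintro h; simp [← h, Real.zero_rpow hp.ne'] at h0)
  have hsub : ball w₀ (d / 2) ⊆ ball z ρ := by
    refine ball_subset_ball' ?_
    rw [dist_eq_norm]; linarith
  have hgrow : ∀ w ∈ ball w₀ (d / 2), ‖f w‖ ≤ l * ‖f w₀‖ := by
    intro w hw
    have h1 := hmax (ball_subset_closedBall (hsub hw))
    have h2 : d / 2 ≤ ρ - ‖w - z‖ := by
      rw [mem_ball, dist_eq_norm] at hw
      have : ‖w - z‖ ≤ ‖w - w₀‖ + ‖w₀ - z‖ := norm_sub_le_norm_sub_add_norm_sub _ _ _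
      linarith
    have h3 : ‖f w‖ ^ p * (d / 2) ^ 2 ≤ ‖f w₀‖ ^ p * d ^ 2 :=
      le_trans (mul_le_mul_of_nonneg_left (pow_le_pow_left₀ (by positivity) h2 2)
        (by positivity)) h1
    have h4 : ‖f w‖ ^ p ≤ 4 * ‖f w₀‖ ^ p := by
      have : 0 < d ^ 2 := by positivity
      nlinarith
    rw [← Real.rpow_le_rpow_iff (norm_nonneg _) (by positivity) hp,
      Real.mul_rpow hlpos.le hfpos.le, hlp]
    exact h4
  have hmaps : MapsTo f (ball w₀ (d / 2)) (closedBall (f w₀) ((l + 2) * ‖f w₀‖)) := by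
    intro w hw
    rw [mem_closedBall, dist_eq_norm]
    have := hgrow w hw
    have := norm_sub_le (f w) (f w₀)
    nlinarith
  have hlow : ∀ w ∈ ball w₀ (c * d), (‖f w₀‖ / 2) ^ p ≤ ‖f w‖ ^ p := by
    intro w hw
    have hw' : w ∈ ball w₀ (d / 2) := ball_subset_ball (by nlinarith) hw
    have h1 := Complex.dist_le_div_mul_dist_of_mapsTo_ball
      (hf.mono (hsub.trans ball_subset_closedBall)) hmaps hw'
    have h2 : dist (f w) (f w₀) ≤ ‖f w₀‖ / 2 := by
      refine h1.trans ?_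
      calc (l + 2) * ‖f w₀‖ / (d / 2) * dist w w₀ ≤ (l + 2) * ‖f w₀‖ / (d / 2) * (c * d) := by
            gcongr; exact (mem_ball.1 hw).le
        _ = ‖f w₀‖ / 2 := by rw [hc]; field_simp; norm_num
    refine Real.rpow_le_rpow (by positivity) ?_ hp.le
    have : ‖f w₀‖ ≤ ‖f w‖ + ‖f w - f w₀‖ := by
      simpa using norm_sub_le (f w) (f w - f w₀)
    rw [dist_eq_norm] at h2
    linarith
  have hint : ENNReal.ofReal ((‖f w₀‖ / 2) ^ p) * (ENNReal.ofReal (c * d) ^ 2 *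
      ENNReal.ofReal Real.pi) ≤ ∫⁻ w in ball z ρ, ENNReal.ofReal (‖f w‖ ^ p) := by
    have hv : volume (ball w₀ (c * d)) = ENNReal.ofReal (c * d) ^ 2 * ENNReal.ofReal Real.pi := by
      rw [Complex.volume_ball, ← NNReal.coe_real_pi, ENNReal.ofReal_coe_nnreal]
    rw [← hv, ← setLIntegral_const]
    refine (setLIntegral_mono' measurableSet_ball fun w hw =>
      ENNReal.ofReal_le_ofReal (hlow w hw)).trans (lintegral_mono_set ?_)
    exact (ball_subset_ball (by nlinarith)).trans hsub
  refine le_trans ?_ (mul_le_mul_right hint _)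
  rw [← ENNReal.ofReal_pow (by positivity), ← ENNReal.ofReal_mul (by positivity),
    ← ENNReal.ofReal_mul (by positivity), ← ENNReal.ofReal_mul (by positivity)]
  refine ENNReal.ofReal_le_ofReal (hz.trans (le_of_eq ?_))
  rw [Real.div_rpow hfpos.le (by norm_num)]
  have := Real.pi_pos
  field_simp

/-- The density `|f|^p (1 - |z|)^a`. -/
def density (f : ℂ → ℂ) (p a : ℝ) (z : ℂ) : ENNReal :=
  ENNReal.ofReal (‖f z‖ ^ p * (1 - ‖z‖) ^ a)

lemma one_sub_norm_bounds {z w : ℂ} (h : w ∈ ball z ((1 - ‖z‖) / 2)) :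
    (1 - ‖z‖) ≤ 2 * (1 - ‖w‖) ∧ 1 - ‖w‖ ≤ 2 * (1 - ‖z‖) ∧ 0 < 1 - ‖z‖ := by
  rw [mem_ball, dist_eq_norm] at h
  have h1 := norm_sub_norm_le w z
  have h2 := norm_sub_norm_le z w
  rw [norm_sub_rev] at h2
  have := norm_nonneg (w - z)
  refine ⟨?_, ?_, ?_⟩ <;> linarith

lemma lintegral_ball_le_density (f : ℂ → ℂ) (p a : ℝ) {z : ℂ} :
    ENNReal.ofReal ((1 - ‖z‖) ^ a) *
        ∫⁻ w in ball z ((1 - ‖z‖) / 2), ENNReal.ofReal (‖f w‖ ^ p) ≤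
      ENNReal.ofReal (2 ^ |a|) * ∫⁻ w in ball z ((1 - ‖z‖) / 2), density f p a w := by
  rw [← lintegral_const_mul' _ _ ENNReal.ofReal_ne_top,
    ← lintegral_const_mul' _ _ ENNReal.ofReal_ne_top]
  refine setLIntegral_mono' measurableSet_ball fun w hw => ?_
  obtain ⟨h1, h2, h3⟩ := one_sub_norm_bounds hw
  rw [density, ← ENNReal.ofReal_mul (by positivity), ← ENNReal.ofReal_mul (by positivity)]
  refine ENNReal.ofReal_le_ofReal ?_
  have := rpow_le_of_comparable a h3 (by linarith) one_le_two h1 h2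
  calc _ ≤ (2 ^ |a| * (1 - ‖w‖) ^ a) * ‖f w‖ ^ p := by gcongr
    _ = _ := by ring

lemma closedBall_subset_unitDisk {z : ℂ} (hz : z ∈ unitDisk) :
    closedBall z ((1 - ‖z‖) / 2) ⊆ unitDisk := by
  rw [mem_unitDisk] at hz
  refine closedBall_subset_ball' ?_
  rw [dist_zero_right]; linarith

/-- On a ball whose radius is half the distance to the circle the weight changes by a factor of at
most `2 ^ |a|`, so it can be moved inside the average. -/
lemma local_norm_le {p : ℝ} (hp : 0 < p) (a : ℝ) : ∃ K : ℝ, 0 < K ∧ ∀ f ∈ holo, ∀ z ∈ unitDisk,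
    ENNReal.ofReal (‖f z‖ ^ p * (1 - ‖z‖) ^ (a + 2)) ≤
      ENNReal.ofReal K * ∫⁻ w in ball z ((1 - ‖z‖) / 2), density f p a w := by
  obtain ⟨K, hK, h⟩ := rpow_norm_le_lintegral hp
  refine ⟨4 * K * 2 ^ |a|, by positivity, fun f hf z hz => ?_⟩
  have hz' : 0 < 1 - ‖z‖ := by rw [mem_unitDisk] at hz; linarith
  have h1 := h f z ((1 - ‖z‖) / 2) (by linarith) (hf.mono (closedBall_subset_unitDisk hz))
  calc _ = ENNReal.ofReal (4 * (1 - ‖z‖) ^ a) *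
        ENNReal.ofReal (‖f z‖ ^ p * ((1 - ‖z‖) / 2) ^ 2) := by
        rw [← ENNReal.ofReal_mul (by positivity), Real.rpow_add hz', Real.rpow_two]
        congr 1; ring
    _ ≤ ENNReal.ofReal (4 * (1 - ‖z‖) ^ a) * (ENNReal.ofReal K *
        ∫⁻ w in ball z ((1 - ‖z‖) / 2), ENNReal.ofReal (‖f w‖ ^ p)) := by gcongr
    _ = ENNReal.ofReal (4 * K) * (ENNReal.ofReal ((1 - ‖z‖) ^ a) *
        ∫⁻ w in ball z ((1 - ‖z‖) / 2), ENNReal.ofReal (‖f w‖ ^ p)) := by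
        rw [ENNReal.ofReal_mul (by positivity), ENNReal.ofReal_mul (by positivity)]; ring
    _ ≤ ENNReal.ofReal (4 * K) * (ENNReal.ofReal (2 ^ |a|) *
        ∫⁻ w in ball z ((1 - ‖z‖) / 2), density f p a w) :=
        mul_le_mul_right (lintegral_ball_le_density f p a) _
    _ = _ := by rw [ENNReal.ofReal_mul (by positivity : 0 ≤ 4 * K), mul_assoc]

lemma local_norm_deriv_le {p : ℝ} (hp : 0 < p) (a : ℝ) : ∃ K : ℝ, 0 < K ∧ ∀ f ∈ holo,
    ∀ z ∈ unitDisk, ENNReal.ofReal (‖deriv f z‖ ^ p * (1 - ‖z‖) ^ (a + p + 2)) ≤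
      ENNReal.ofReal K * ∫⁻ w in ball z ((1 - ‖z‖) / 2), density f p a w := by
  obtain ⟨K, hK, h⟩ := rpow_norm_le_lintegral hp
  refine ⟨4 ^ p * (16 * K) * 2 ^ |a|, by positivity, fun f hf z hz => ?_⟩
  have hz' : 0 < 1 - ‖z‖ := by rw [mem_unitDisk] at hz; linarith
  set D := 1 - ‖z‖ with hD
  set J := ∫⁻ w in ball z (D / 2), ENNReal.ofReal (‖f w‖ ^ p) with hJ
  have key : ENNReal.ofReal (‖deriv f z‖ ^ p * D ^ (p + 2)) ≤
      ENNReal.ofReal (4 ^ p * (16 * K)) * J := by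
    rcases eq_or_ne J ⊤ with hT | hT
    · rw [hT, ENNReal.mul_top (by simp; positivity)]; exact le_top
    obtain ⟨j, hj⟩ : ∃ j : NNReal, J = j := ⟨J.toNNReal, (ENNReal.coe_toNNReal hT).symm⟩
    rw [hj]
    -- Cauchy's estimate on a circle of radius `D / 4`: the averaging balls of radius `D / 4` about
    -- its points stay inside the ball of radius `D / 2`.
    have hw : ∀ w ∈ sphere z (D / 4), ‖f w‖ ≤ (16 * K * j / D ^ 2) ^ (1 / p) := by
      intro w hw
      have hs : closedBall w (D / 4) ⊆ closedBall z (D / 2) :=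
        closedBall_subset_closedBall' (by rw [mem_sphere.1 hw]; linarith)
      have h1 := h f w (D / 4) (by linarith)
        (hf.mono (hs.trans (closedBall_subset_unitDisk hz)))
      have h2 : ENNReal.ofReal (‖f w‖ ^ p * (D / 4) ^ 2) ≤ ENNReal.ofReal K * j := by
        refine h1.trans (mul_le_mul_right ?_ _)
        rw [← hj, hJ]
        refine lintegral_mono_set (ball_subset_ball' (by rw [mem_sphere.1 hw]; linarith))
      rw [← ENNReal.ofReal_coe_nnreal, ← ENNReal.ofReal_mul hK.le,
        ENNReal.ofReal_le_ofReal_iff (by positivity)] at h2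
      rw [one_div, Real.le_rpow_inv_iff_of_pos (norm_nonneg _) (by positivity) hp]
      rw [le_div_iff₀ (by positivity)]
      linarith
    have h3 := Complex.norm_deriv_le_of_forall_mem_sphere_norm_le (by linarith : 0 < D / 4)
      ((hf.mono ((closedBall_subset_closedBall (by linarith)).trans
        (closedBall_subset_unitDisk hz))).diffContOnCl_ball subset_rfl) hw
    rw [← ENNReal.ofReal_coe_nnreal, ← ENNReal.ofReal_mul (by positivity)]
    refine ENNReal.ofReal_le_ofReal ?_
    calc ‖deriv f z‖ ^ p * D ^ (p + 2)
        ≤ ((16 * K * j / D ^ 2) ^ (1 / p) / (D / 4)) ^ p * D ^ (p + 2) := by gcongr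
      _ = _ := by
        rw [Real.div_rpow (by positivity) (by positivity), ← Real.rpow_mul (by positivity),
          one_div_mul_cancel hp.ne', Real.rpow_one, Real.div_rpow (by positivity) (by norm_num),
          Real.rpow_add hz', Real.rpow_two]
        field_simp
  calc _ = ENNReal.ofReal (D ^ a) * ENNReal.ofReal (‖deriv f z‖ ^ p * D ^ (p + 2)) := by
        rw [← ENNReal.ofReal_mul (by positivity), add_assoc, Real.rpow_add hz' a]
        congr 1; ring
    _ ≤ ENNReal.ofReal (D ^ a) * (ENNReal.ofReal (4 ^ p * (16 * K)) * J) := by gcongr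
    _ = ENNReal.ofReal (4 ^ p * (16 * K)) * (ENNReal.ofReal (D ^ a) * J) := by ring
    _ ≤ ENNReal.ofReal (4 ^ p * (16 * K)) * (ENNReal.ofReal (2 ^ |a|) *
        ∫⁻ w in ball z ((1 - ‖z‖) / 2), density f p a w) :=
        mul_le_mul_right (lintegral_ball_le_density f p a) _
    _ = _ := by rw [ENNReal.ofReal_mul (by positivity : 0 ≤ 4 ^ p * (16 * K)), mul_assoc]

/-! ### Mass of the weight near a boundary point, and Tonelli's theorem -/

lemma setLIntegral_Ioo_rpow {b δ : ℝ} (hb : -1 < b) (hδ : 0 < δ) :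
    ∫⁻ x in Ioo 0 δ, ENNReal.ofReal (x ^ b) = ENNReal.ofReal (δ ^ (b + 1) / (b + 1)) := by
  have hi : IntervalIntegrable (fun x : ℝ => x ^ b) volume 0 δ :=
    intervalIntegral.intervalIntegrable_rpow' hb
  rw [intervalIntegrable_iff_integrableOn_Ioo_of_le hδ.le] at hi
  rw [← ofReal_integral_eq_lintegral_ofReal hi, ← integral_Ioc_eq_integral_Ioo,
    ← intervalIntegral.integral_of_le hδ.le, integral_rpow (Or.inl hb)]
  · rw [Real.zero_rpow (by linarith), sub_zero]
  · refine (ae_restrict_iff' measurableSet_Ioo).2 (Filter.Eventually.of_forall fun x hx => ?_)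
    exact Real.rpow_nonneg hx.1.le _

lemma setLIntegral_Ioo_one_sub_rpow {b δ : ℝ} (hb : -1 < b) (hδ : 0 < δ) :
    ∫⁻ x in Ioo (1 - δ) 1, ENNReal.ofReal ((1 - x) ^ b) =
      ENNReal.ofReal (δ ^ (b + 1) / (b + 1)) := by
  rw [← setLIntegral_Ioo_rpow hb hδ]
  have h := (Measure.measurePreserving_sub_left (volume : Measure ℝ) 1).setLIntegral_comp_preimage
    (measurableSet_Ioo (a := (0 : ℝ)) (b := δ))
    (f := fun x => ENNReal.ofReal (x ^ b)) (by fun_prop)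
  rw [← h]
  congr 2
  ext x; simp only [mem_Ioo, mem_preimage]; constructor <;> rintro ⟨h1, h2⟩ <;>
    constructor <;> linarith

/-- In polar coordinates the region lies in the rectangle `1 - δ < r < 1`, `|t| ≤ π δ`, where the
integral splits; the Jacobian `r` is at most one. -/
lemma weight_ball_one_le {b : ℝ} (hb : -1 < b) {δ : ℝ} (hδ : 0 < δ) :
    ∫⁻ z in ball 1 δ ∩ unitDisk, ENNReal.ofReal ((1 - ‖z‖) ^ b) ≤
      ENNReal.ofReal (2 * Real.pi / (b + 1) * δ ^ (b + 2)) := by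
  have hpi := Real.pi_pos
  have hm : MeasurableSet (ball (1 : ℂ) δ ∩ unitDisk) := measurableSet_ball.inter measurableSet_ball
  rw [← lintegral_indicator hm, ← Complex.lintegral_comp_polarCoord_symm]
  set u : ℝ → ENNReal := (Ioo (1 - δ) 1).indicator (fun r => ENNReal.ofReal ((1 - r) ^ b)) with hu
  set v : ℝ → ENNReal := (Icc (-(Real.pi * δ)) (Real.pi * δ)).indicator 1 with hv
  have hle : ∀ x ∈ polarCoord.target, ENNReal.ofReal x.1 • (ball (1 : ℂ) δ ∩ unitDisk).indicator
      (fun z => ENNReal.ofReal ((1 - ‖z‖) ^ b)) (Complex.polarCoord.symm x) ≤ u x.1 * v x.2 := by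
    rintro ⟨r, t⟩ hrt
    simp only [polarCoord_target, mem_prod, mem_Ioi, mem_Ioo] at hrt
    obtain ⟨hr, ht⟩ := hrt
    have hz : Complex.polarCoord.symm (r, t) = r * Complex.exp (t * Complex.I) := by
      rw [Complex.polarCoord_symm_apply, Complex.exp_mul_I]; simp
    rw [hz]
    have hn : ‖(r : ℂ) * Complex.exp (t * Complex.I)‖ = r := by
      rw [norm_mul, Complex.norm_exp_ofReal_mul_I]; simp [abs_of_pos hr]
    by_cases hmem : (r : ℂ) * Complex.exp (t * Complex.I) ∈ ball (1 : ℂ) δ ∩ unitDisk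
    · have ⟨h1, h2⟩ := hmem
      rw [indicator_of_mem hmem, hn]
      rw [mem_unitDisk, hn] at h2
      rw [mem_ball, dist_eq_norm] at h1
      have h3 : 1 - r < δ := by
        have := norm_sub_norm_le (1 : ℂ) (r * Complex.exp (t * Complex.I))
        rw [hn, norm_one, norm_sub_rev] at this
        linarith
      have h4 : |t| ≤ Real.pi * δ := by
        have ha := Complex.angle_le_mul_norm_sub
          (Complex.norm_exp_ofReal_mul_I t) (norm_one (α := ℂ))
        rw [Complex.angle_one_right (Complex.exp_ne_zero _), Complex.arg_exp_mul_I,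
          (toIocMod_eq_self Real.two_pi_pos).2 ⟨ht.1, by linarith [ht.2]⟩] at ha
        have h5 : ‖Complex.exp (t * Complex.I) - 1‖ ≤ 2 * δ := by
          have h6 := norm_sub_le_norm_sub_add_norm_sub (Complex.exp (t * Complex.I))
            (r * Complex.exp (t * Complex.I)) 1
          have h7 : ‖Complex.exp (t * Complex.I) - r * Complex.exp (t * Complex.I)‖ = 1 - r := by
            rw [← one_sub_mul, norm_mul, Complex.norm_exp_ofReal_mul_I, mul_one, ← Complex.ofReal_one,
              ← Complex.ofReal_sub, Complex.norm_real, Real.norm_of_nonneg (by linarith)]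
          linarith
        refine ha.trans ?_
        nlinarith
      rw [hu, hv, indicator_of_mem (show r ∈ Ioo (1 - δ) 1 from ⟨by linarith, h2⟩),
        indicator_of_mem (show t ∈ Icc (-(Real.pi * δ)) (Real.pi * δ) from abs_le.1 h4)]
      simp only [Pi.one_apply, mul_one, smul_eq_mul]
      refine mul_le_of_le_one_left' ?_
      simpa using h2.le
    · rw [indicator_of_notMem hmem]; simp
  refine (setLIntegral_mono' polarCoord.open_target.measurableSet hle).trans ?_
  refine (setLIntegral_le_lintegral _ _).trans ?_
  have hum : Measurable u := (by fun_prop : Measurable fun r : ℝ =>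
    ENNReal.ofReal ((1 - r) ^ b)).indicator measurableSet_Ioo
  have hvm : Measurable v := measurable_one.indicator measurableSet_Icc
  rw [Measure.volume_eq_prod, lintegral_prod_mul hum.aemeasurable hvm.aemeasurable, hu, hv,
    lintegral_indicator measurableSet_Ioo, lintegral_indicator_one measurableSet_Icc,
    setLIntegral_Ioo_one_sub_rpow hb hδ, Real.volume_Icc, ← ENNReal.ofReal_mul
    (div_nonneg (by positivity) (by linarith))]
  refine ENNReal.ofReal_le_ofReal (le_of_eq ?_)
  rw [show b + 2 = b + 1 + 1 by ring, Real.rpow_add hδ (b + 1), Real.rpow_one]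
  ring

lemma weight_ball_le {b : ℝ} (hb : -1 < b) {ξ : ℂ} (hξ : ‖ξ‖ = 1) {δ : ℝ} (hδ : 0 < δ) :
    ∫⁻ z in ball ξ δ ∩ unitDisk, ENNReal.ofReal ((1 - ‖z‖) ^ b) ≤
      ENNReal.ofReal (2 * Real.pi / (b + 1) * δ ^ (b + 2)) := by
  refine le_trans (le_of_eq ?_) (weight_ball_one_le hb hδ)
  let c : Circle := ⟨ξ, mem_sphere_zero_iff_norm.2 hξ⟩
  have h := (rotation c).measurePreserving.setLIntegral_comp_preimage
    (s := ball ξ δ ∩ unitDisk) (measurableSet_ball.inter measurableSet_ball)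
    (f := fun z => ENNReal.ofReal ((1 - ‖z‖) ^ b)) (by fun_prop)
  rw [← h]
  have hc : (c : ℂ) = ξ := rfl
  simp only [LinearIsometryEquiv.norm_map]
  congr 2
  ext z
  simp only [mem_preimage, mem_inter_iff, mem_unitDisk, mem_ball, dist_eq_norm, rotation_apply, hc]
  have : ξ * z - ξ = ξ * (z - 1) := by ring
  rw [this, norm_mul, norm_mul, hξ, one_mul, one_mul]

/-- Integrating a local-average estimate over `z` and swapping leaves, for each `w`, the weight of
those `z` whose average sees `w`. Both the derivative and the integration estimate reduce to this.
-/
lemma setLIntegral_mul_setLIntegral_swap {R : Set (ℂ × ℂ)} (hR : MeasurableSet R)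
    {E E' : Set ℂ} {v φ : ℂ → ENNReal}
    (hv : AEMeasurable v (volume.restrict E)) (hφ : AEMeasurable φ (volume.restrict E')) :
    ∫⁻ z in E, v z * ∫⁻ w in E' ∩ {w | (z, w) ∈ R}, φ w =
      ∫⁻ w in E', φ w * ∫⁻ z in E ∩ {z | (z, w) ∈ R}, v z := by
  have hz : ∀ z, MeasurableSet {w | (z, w) ∈ R} := fun z => measurable_prodMk_left hR
  have hw : ∀ w, MeasurableSet {z | (z, w) ∈ R} := fun w => measurable_prodMk_right hR
  have h1 : ∀ z, AEMeasurable φ (volume.restrict (E' ∩ {w | (z, w) ∈ R})) := fun z =>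
    hφ.mono_measure (Measure.restrict_mono inter_subset_left le_rfl)
  have h2 : ∀ w, AEMeasurable v (volume.restrict (E ∩ {z | (z, w) ∈ R})) := fun w =>
    hv.mono_measure (Measure.restrict_mono inter_subset_left le_rfl)
  have e1 : ∀ z, v z * ∫⁻ w in E' ∩ {w | (z, w) ∈ R}, φ w =
      ∫⁻ w in E', R.indicator (fun x => v x.1 * φ x.2) (z, w) := by
    intro z
    rw [← lintegral_const_mul'' _ (h1 z), inter_comm, ← Measure.restrict_restrict (hz z),
      ← lintegral_indicator (hz z)]
    rfl
  have e2 : ∀ w, φ w * ∫⁻ z in E ∩ {z | (z, w) ∈ R}, v z =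
      ∫⁻ z in E, R.indicator (fun x => v x.1 * φ x.2) (z, w) := by
    intro w
    rw [← lintegral_const_mul'' _ (h2 w), inter_comm, ← Measure.restrict_restrict (hw w),
      ← lintegral_indicator (hw w)]
    simp only [indicator, mul_comm (φ w)]
    rfl
  simp only [e1, e2]
  refine lintegral_lintegral_swap ?_
  exact ((hv.comp_fst).mul (hφ.comp_snd)).indicator hR

/-! ### Carleson bounds: pointwise growth and derivatives -/

/-- The Carleson measure condition for `|f|^p (1 - |z|)^a dA`, tested on balls centred on the
unit circle. -/
def CarlesonBound (f : ℂ → ℂ) (p a C : ℝ) : Prop :=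
  ∀ ξ : ℂ, ‖ξ‖ = 1 → ∀ δ : ℝ, 0 < δ →
    ∫⁻ z in ball ξ δ ∩ unitDisk, density f p a z ≤ ENNReal.ofReal (C * δ)

lemma exists_norm_eq_one_norm_sub (z : ℂ) (hz : z ∈ unitDisk) :
    ∃ ξ : ℂ, ‖ξ‖ = 1 ∧ ‖z - ξ‖ = 1 - ‖z‖ := by
  rw [mem_unitDisk] at hz
  rcases eq_or_ne z 0 with rfl | h0
  · exact ⟨1, by simp, by simp⟩
  · have hpos : 0 < ‖z‖ := norm_pos_iff.2 h0
    have hne : (‖z‖ : ℂ) ≠ 0 := by exact_mod_cast hpos.ne'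
    refine ⟨z / ‖z‖, by simp [h0], ?_⟩
    have : z - z / ‖z‖ = z / ‖z‖ * ((‖z‖ - 1 : ℝ) : ℂ) := by push_cast; field_simp
    rw [this, norm_mul, Complex.norm_real, Real.norm_of_nonpos (by linarith)]
    simp [h0]

lemma aemeasurable_density {f : ℂ → ℂ} (hf : f ∈ holo) {p : ℝ} (hp : 0 < p) (a : ℝ) {E : Set ℂ}
    (hE : E ⊆ unitDisk) : AEMeasurable (density f p a) (volume.restrict E) := by
  refine AEMeasurable.mono_measure ?_ (Measure.restrict_mono hE le_rfl)
  refine AEMeasurable.ennreal_ofReal ?_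
  refine AEMeasurable.mul ?_ (by fun_prop)
  refine ContinuousOn.aemeasurable ?_ isOpen_unitDisk.measurableSet
  exact (DifferentiableOn.continuousOn hf).norm.rpow_const fun _ _ => Or.inr hp.le

/-- The averaging ball about `z` lies within `2 * (1 - ‖z‖)` of the nearest boundary point. Only
this one radius is assumed, which lets the estimate be used before the full Carleson bound is known.
-/
lemma pointwise_of_ball_bound {p : ℝ} (hp : 0 < p) (a : ℝ) : ∃ K : ℝ, 0 < K ∧ ∀ f ∈ holo,
    ∀ z ∈ unitDisk, ∀ C : ℝ, 0 ≤ C →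
    (∀ ξ : ℂ, ‖ξ‖ = 1 → ∫⁻ w in ball ξ (2 * (1 - ‖z‖)) ∩ unitDisk, density f p a w ≤
      ENNReal.ofReal (C * (2 * (1 - ‖z‖)))) →
    ‖f z‖ ^ p * (1 - ‖z‖) ^ (a + 1) ≤ K * C := by
  obtain ⟨K, hK, h⟩ := local_norm_le hp a
  refine ⟨2 * K, by positivity, fun f hf z hz C hC hb => ?_⟩
  have hz' : 0 < 1 - ‖z‖ := by rw [mem_unitDisk] at hz; linarith
  obtain ⟨ξ, hξ, hzξ⟩ := exists_norm_eq_one_norm_sub z hz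
  have h1 := (h f hf z hz).trans (mul_le_mul_right ((lintegral_mono_set (subset_inter
    (ball_subset_ball' (by rw [dist_eq_norm, hzξ]; linarith))
    (ball_subset_closedBall.trans (closedBall_subset_unitDisk hz)))).trans (hb ξ hξ)) _)
  rw [← ENNReal.ofReal_mul hK.le, ENNReal.ofReal_le_ofReal_iff (by positivity),
    show a + 2 = a + 1 + 1 by ring, Real.rpow_add hz' (a + 1), Real.rpow_one] at h1
  refine le_of_mul_le_mul_right ?_ hz'
  linarith

lemma CarlesonBound.pointwise {p : ℝ} (hp : 0 < p) (a : ℝ) : ∃ K : ℝ, 0 < K ∧ ∀ f ∈ holo,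
    ∀ C : ℝ, 0 ≤ C → CarlesonBound f p a C → ∀ z ∈ unitDisk,
    ‖f z‖ ^ p * (1 - ‖z‖) ^ (a + 1) ≤ K * C := by
  obtain ⟨K, hK, h⟩ := pointwise_of_ball_bound hp a
  refine ⟨K, hK, fun f hf C hC hb z hz => h f hf z hz C hC fun ξ hξ => hb ξ hξ _ ?_⟩
  rw [mem_unitDisk] at hz; linarith

lemma density_le_mul_of_le {f : ℂ → ℂ} {p a b : ℝ} {z : ℂ} (hz : z ∈ unitDisk) {X : ENNReal}
    (h : ENNReal.ofReal (‖f z‖ ^ p * (1 - ‖z‖) ^ b) ≤ X) :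
    density f p a z ≤ ENNReal.ofReal ((1 - ‖z‖) ^ (a - b)) * X := by
  have hz' : 0 < 1 - ‖z‖ := by rw [mem_unitDisk] at hz; linarith
  refine le_trans (le_of_eq ?_) (mul_le_mul_right h _)
  rw [density, ← ENNReal.ofReal_mul (by positivity), mul_left_comm, ← Real.rpow_add hz',
    sub_add_cancel]

/-- After the swap, the points `z` seeing a given `w` fill an area of order `(1 - ‖w‖) ^ 2`, which
cancels the weight `(1 - ‖z‖) ^ (-2)` left by the local estimate. -/
lemma CarlesonBound.deriv {p : ℝ} (hp : 0 < p) (a : ℝ) : ∃ K : ℝ, 0 < K ∧ ∀ f ∈ holo,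
    ∀ C : ℝ, 0 ≤ C → CarlesonBound f p a C → CarlesonBound (deriv f) p (a + p) (K * C) := by
  obtain ⟨K, hK, h⟩ := local_norm_deriv_le hp a
  have hpi := Real.pi_pos
  refine ⟨K * (4 * Real.pi * 2), by positivity, fun f hf C hC hb ξ hξ δ hδ => ?_⟩
  set R : Set (ℂ × ℂ) := {x | ‖x.2 - x.1‖ < (1 - ‖x.1‖) / 2} with hR
  have hRm : MeasurableSet R := measurableSet_lt (by fun_prop) (by fun_prop)
  set v : ℂ → ENNReal := fun z => ENNReal.ofReal ((1 - ‖z‖) ^ (-2 : ℝ)) with hv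
  set E := ball ξ δ ∩ unitDisk with hE
  set E' := ball ξ (2 * δ) ∩ unitDisk with hE'
  have hEm : MeasurableSet E := measurableSet_ball.inter measurableSet_ball
  have hEm' : MeasurableSet E' := measurableSet_ball.inter measurableSet_ball
  have step1 : ∀ z ∈ E, density (_root_.deriv f) p (a + p) z ≤
      ENNReal.ofReal K * (v z * ∫⁻ w in E' ∩ {w | (z, w) ∈ R}, density f p a w) := by
    rintro z ⟨hz1, hz⟩
    have hz' : 0 < 1 - ‖z‖ := by rw [mem_unitDisk] at hz; linarith
    refine (density_le_mul_of_le hz (h f hf z hz)).trans ?_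
    rw [mul_left_comm, show a + p - (a + p + 2) = -2 by ring]
    refine mul_le_mul_right (mul_le_mul_right (lintegral_mono_set fun w hw => ?_) _) _
    have hw1 := closedBall_subset_unitDisk hz (ball_subset_closedBall hw)
    rw [mem_ball, dist_eq_norm] at hw hz1
    refine ⟨⟨?_, hw1⟩, hw⟩
    rw [mem_ball, dist_eq_norm]
    have h1 := norm_sub_le_norm_sub_add_norm_sub w z ξ
    have h2 := norm_sub_norm_le ξ z
    rw [hξ, norm_sub_rev] at h2
    linarith
  have step2 : ∀ w ∈ E', density f p a w * ∫⁻ z in E ∩ {z | (z, w) ∈ R}, v z ≤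
      ENNReal.ofReal (4 * Real.pi) * density f p a w := by
    rintro w ⟨-, hw⟩
    rw [mul_comm]
    refine mul_le_mul_left ?_ _
    have hw' : 0 < 1 - ‖w‖ := by rw [mem_unitDisk] at hw; linarith
    have hvol : volume (ball w (1 - ‖w‖)) =
        ENNReal.ofReal (1 - ‖w‖) ^ 2 * ENNReal.ofReal Real.pi := by
      rw [Complex.volume_ball, ← NNReal.coe_real_pi, ENNReal.ofReal_coe_nnreal]
    calc ∫⁻ z in E ∩ {z | (z, w) ∈ R}, v z
        ≤ ∫⁻ z in E ∩ {z | (z, w) ∈ R}, ENNReal.ofReal (4 * (1 - ‖w‖) ^ (-2 : ℝ)) := by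
          refine setLIntegral_mono' (hEm.inter (measurable_prodMk_right hRm)) fun z hz => ?_
          obtain ⟨h1, h2, h3⟩ := one_sub_norm_bounds
            (show w ∈ ball z ((1 - ‖z‖) / 2) by rw [mem_ball, dist_eq_norm]; exact hz.2)
          refine ENNReal.ofReal_le_ofReal ?_
          refine (rpow_le_of_comparable _ h3 hw' one_le_two h1 h2).trans_eq ?_
          norm_num
      _ ≤ ∫⁻ z in ball w (1 - ‖w‖), ENNReal.ofReal (4 * (1 - ‖w‖) ^ (-2 : ℝ)) := by
          refine lintegral_mono_set fun z hz => ?_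
          have hz2 : ‖w - z‖ < (1 - ‖z‖) / 2 := hz.2
          obtain ⟨h1, h2, h3⟩ := one_sub_norm_bounds
            (show w ∈ ball z ((1 - ‖z‖) / 2) by rw [mem_ball, dist_eq_norm]; exact hz.2)
          rw [mem_ball, dist_eq_norm, norm_sub_rev]; linarith
      _ = _ := by
          rw [setLIntegral_const, hvol, ← ENNReal.ofReal_pow hw'.le,
            ← ENNReal.ofReal_mul (by positivity), ← ENNReal.ofReal_mul (by positivity)]
          congr 1
          rw [Real.rpow_neg hw'.le, Real.rpow_two]
          field_simp
  calc ∫⁻ z in E, density (_root_.deriv f) p (a + p) z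
      ≤ ∫⁻ z in E, ENNReal.ofReal K *
          (v z * ∫⁻ w in E' ∩ {w | (z, w) ∈ R}, density f p a w) := setLIntegral_mono' hEm step1
    _ = ENNReal.ofReal K * ∫⁻ w in E', density f p a w * ∫⁻ z in E ∩ {z | (z, w) ∈ R}, v z := by
        rw [lintegral_const_mul' _ _ ENNReal.ofReal_ne_top,
          setLIntegral_mul_setLIntegral_swap hRm (by fun_prop)
            (aemeasurable_density hf hp a inter_subset_right)]
    _ ≤ ENNReal.ofReal K * ∫⁻ w in E', ENNReal.ofReal (4 * Real.pi) * density f p a w :=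
        mul_le_mul_right (setLIntegral_mono' hEm' step2) _
    _ ≤ ENNReal.ofReal K * (ENNReal.ofReal (4 * Real.pi) * ENNReal.ofReal (C * (2 * δ))) := by
        rw [lintegral_const_mul' _ _ ENNReal.ofReal_ne_top]
        exact mul_le_mul_right (mul_le_mul_right (hb ξ hξ _ (by positivity)) _) _
    _ = _ := by
        rw [← ENNReal.ofReal_mul (by positivity), ← ENNReal.ofReal_mul (by positivity)]
        congr 1; ring

/-! ### The integration operator and its effect on Carleson bounds -/

lemma norm_integrationOp_le {h : ℂ → ℂ} {z : ℂ} (hz : z ∈ unitDisk) {R ε : ℝ} (hR : 0 ≤ R)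
    (hε : 0 < ε) (hb : ∀ s ∈ Icc (0 : ℝ) 1, ‖h (s * z)‖ ≤ R * (1 - s * ‖z‖) ^ (-1 - ε)) :
    ‖integrationOp h z‖ ≤ R / ε * (1 - ‖z‖) ^ (-ε) := by
  rw [mem_unitDisk] at hz
  have hpos : ∀ s ∈ uIcc (0 : ℝ) 1, 0 < 1 - s * ‖z‖ := by
    intro s hs
    rw [uIcc_of_le zero_le_one] at hs
    nlinarith [hs.1, hs.2, norm_nonneg z]
  have hcont : ContinuousOn (fun s : ℝ => R * (1 - s * ‖z‖) ^ (-1 - ε) * ‖z‖) (uIcc 0 1) := by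
    refine ContinuousOn.mul (ContinuousOn.mul (by fun_prop) ?_) (by fun_prop)
    exact ContinuousOn.rpow_const (by fun_prop) fun s hs => Or.inl (hpos s hs).ne'
  have h1 : ‖integrationOp h z‖ ≤ ∫ s in (0 : ℝ)..1, R * (1 - s * ‖z‖) ^ (-1 - ε) * ‖z‖ := by
    refine intervalIntegral.norm_integral_le_of_norm_le zero_le_one
      (Filter.Eventually.of_forall fun s hs => ?_) hcont.intervalIntegrable
    rw [norm_mul]
    exact mul_le_mul_of_nonneg_right (hb s ⟨hs.1.le, hs.2⟩) (norm_nonneg _)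
  have h2 : ∀ s ∈ uIcc (0 : ℝ) 1, HasDerivAt (fun s : ℝ => R / ε * (1 - s * ‖z‖) ^ (-ε))
      (R * (1 - s * ‖z‖) ^ (-1 - ε) * ‖z‖) s := by
    intro s hs
    have hd : HasDerivAt (fun s : ℝ => 1 - s * ‖z‖) (-‖z‖) s := by
      simpa using ((hasDerivAt_id s).mul_const ‖z‖).const_sub 1
    have := ((hd.rpow_const (p := -ε) (Or.inl (hpos s hs).ne')).const_mul (R / ε))
    convert! this using 1
    rw [show -1 - ε = -ε - 1 by ring]
    field_simp
  rw [intervalIntegral.integral_eq_sub_of_hasDerivAt h2 hcont.intervalIntegrable] at h1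
  refine h1.trans ?_
  have : 0 ≤ R / ε := by positivity
  simp only [one_mul, zero_mul, sub_zero, Real.one_rpow, mul_one]
  linarith

lemma smul_mem_unitDisk {z : ℂ} (hz : z ∈ unitDisk) {s : ℝ} (hs : s ∈ Icc (0 : ℝ) 1) :
    (s : ℂ) * z ∈ unitDisk ∧ ‖(s : ℂ) * z‖ = s * ‖z‖ := by
  have h : ‖(s : ℂ) * z‖ = s * ‖z‖ := by
    rw [norm_mul, Complex.norm_real, Real.norm_of_nonneg hs.1]
  rw [mem_unitDisk] at *
  refine ⟨?_, h⟩
  rw [h]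
  nlinarith [hs.1, hs.2, norm_nonneg z]

/-- On the disk, `integrationOp h` is the primitive of `h`. -/
lemma hasDerivAt_integrationOp {h : ℂ → ℂ} (hh : h ∈ holo) {z : ℂ} (hz : z ∈ unitDisk) :
    HasDerivAt (integrationOp h) (h z) z := by
  obtain ⟨F, hF⟩ := DifferentiableOn.isExactOn_ball hh
  have heq : ∀ w ∈ unitDisk, integrationOp h w = F w - F 0 := by
    intro w hw
    have h1 : ∀ s ∈ uIcc (0 : ℝ) 1,
        HasDerivAt (fun s : ℝ => F ((s : ℂ) * w)) (h ((s : ℂ) * w) * w) s := by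
      intro s hs
      rw [uIcc_of_le zero_le_one] at hs
      have h2 : HasDerivAt (fun s : ℝ => (s : ℂ) * w) w s := by
        simpa using (Complex.ofRealCLM.hasDerivAt (x := s)).mul_const w
      exact (hF _ (smul_mem_unitDisk hw hs).1).comp s h2
    have h3 : ContinuousOn (fun s : ℝ => h ((s : ℂ) * w) * w) (uIcc 0 1) := by
      refine ContinuousOn.mul ?_ continuousOn_const
      refine (DifferentiableOn.continuousOn hh).comp (by fun_prop) fun s hs => ?_
      rw [uIcc_of_le zero_le_one] at hs
      exact (smul_mem_unitDisk hw hs).1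
    rw [integrationOp, intervalIntegral.integral_eq_sub_of_hasDerivAt h1 h3.intervalIntegrable]
    simp
  refine ((hF z hz).sub_const (F 0)).congr_of_eventuallyEq ?_
  filter_upwards [isOpen_unitDisk.mem_nhds hz] with w hw using heq w hw

lemma integrationOp_mem_holo {h : ℂ → ℂ} (hh : h ∈ holo) : integrationOp h ∈ holo :=
  fun _ hz => (hasDerivAt_integrationOp hh hz).differentiableAt.differentiableWithinAt

lemma iterate_integrationOp_mem_holo {h : ℂ → ℂ} (hh : h ∈ holo) (n : ℕ) :
    integrationOp^[n] h ∈ holo := by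
  induction n with
  | zero => exact hh
  | succ n ih => rw [Function.iterate_succ_apply']; exact integrationOp_mem_holo ih

lemma iteratedDeriv_iterate_integrationOp {h : ℂ → ℂ} (hh : h ∈ holo) (n : ℕ) {z : ℂ}
    (hz : z ∈ unitDisk) : iteratedDeriv n (integrationOp^[n] h) z = h z := by
  induction n with
  | zero => simp
  | succ n ih =>
    rw [Function.iterate_succ_apply', iteratedDeriv_succ', ← ih]
    refine Filter.EventuallyEq.iteratedDeriv_eq n ?_
    filter_upwards [isOpen_unitDisk.mem_nhds hz] with w hw
    exact (hasDerivAt_integrationOp (iterate_integrationOp_mem_holo hh n) hw).deriv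

lemma deriv_mem_holo {f : ℂ → ℂ} (hf : f ∈ holo) : deriv f ∈ holo :=
  DifferentiableOn.deriv hf isOpen_unitDisk

lemma iteratedDeriv_mem_holo {f : ℂ → ℂ} (hf : f ∈ holo) (k : ℕ) : iteratedDeriv k f ∈ holo := by
  induction k with
  | zero => simpa using hf
  | succ k ih => rw [iteratedDeriv_succ]; exact deriv_mem_holo ih

lemma CarlesonBound.iteratedDeriv {p : ℝ} (hp : 0 < p) (a : ℝ) (k : ℕ) :
    ∃ K : ℝ, 0 < K ∧ ∀ f ∈ holo, ∀ C : ℝ, 0 ≤ C → CarlesonBound f p a C →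
      CarlesonBound (iteratedDeriv k f) p (a + k * p) (K * C) := by
  induction k with
  | zero => exact ⟨1, one_pos, fun f _ C _ hb => by simpa using hb⟩
  | succ k ih =>
    obtain ⟨K, hK, h⟩ := ih
    obtain ⟨K', hK', h'⟩ := CarlesonBound.deriv hp (a + k * p)
    refine ⟨K' * K, by positivity, fun f hf C hC hb => ?_⟩
    have := h' _ (iteratedDeriv_mem_holo hf k) (K * C) (by positivity) (h f hf C hC hb)
    rw [iteratedDeriv_succ, mul_assoc]
    convert this using 1
    push_cast; ring

/-- Along the radius to `z`, `|h|^p (1 - s‖z‖)^m` is bounded by one quantity `Q z` independent of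
`s`, and since `m > p` the radial integral of the resulting bound on `|h|` is explicit. No Hölder or
Minkowski inequality enters, so all `p > 0` are treated alike. The points of the radius at depth at
least `δ` are controlled by pointwise growth, the others by an integral over a cone of points `w`,
which the swap then handles. -/
lemma CarlesonBound.integrationOp {p : ℝ} (hp : 0 < p) {a : ℝ} (ha : -1 < a) :
    ∃ K : ℝ, 0 < K ∧ ∀ h ∈ holo, ∀ C : ℝ, 0 ≤ C → CarlesonBound h p (a + p) C →
      CarlesonBound (integrationOp h) p a (K * C) := by
  -- Half of the available room: `ε > 0` makes the radial integral explicit, while the remaining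
  -- weight exponent `b = a - ε * p = (a - 1) / 2` is still above `-1`.
  set ε : ℝ := (a + 1) / (2 * p) with hε
  have hεpos : 0 < ε := div_pos (by linarith) (by linarith)
  have hεp : ε * p = (a + 1) / 2 := by rw [hε]; field_simp
  set m : ℝ := (1 + ε) * p with hm
  have hm' : m = p + (a + 1) / 2 := by rw [hm, add_mul, hεp, one_mul]
  set b : ℝ := (a - 1) / 2 with hb
  have hb1 : -1 < b := by rw [hb]; linarith
  obtain ⟨K₁, hK₁, hpt⟩ := CarlesonBound.pointwise hp (a + p)
  obtain ⟨K₂, hK₂, hloc⟩ := local_norm_le hp (m - 2)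
  rw [sub_add_cancel] at hloc
  set K₃ : ℝ := K₁ + K₂ with hK₃
  have hK₃pos : 0 < K₃ := by positivity
  set W : ℝ := 2 * Real.pi / (b + 1) with hW
  have hWpos : 0 < W := div_pos (by have := Real.pi_pos; linarith) (by linarith)
  refine ⟨K₃ / ε ^ p * (W + W * 4 ^ (b + 2) * 3), by positivity, fun h hh C hC hcb ξ hξ δ hδ => ?_⟩
  -- With `D = 1 - s‖z‖`, the local ball at `s z` gives `‖w - z‖ < 3 D / 2` and `D ≤ 2 * (1 - ‖w‖)`,
  -- hence the constant 3. If also `D < δ`, then `w` is within `3 * δ` of `ξ`.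
  set R : Set (ℂ × ℂ) := {x | ‖x.2 - x.1‖ < 3 * (1 - ‖x.2‖)} with hR
  have hRm : MeasurableSet R := measurableSet_lt (by fun_prop) (by fun_prop)
  set v : ℂ → ENNReal := fun z => ENNReal.ofReal ((1 - ‖z‖) ^ b) with hv
  set E := ball ξ δ ∩ unitDisk with hE
  set E' := ball ξ (3 * δ) ∩ unitDisk with hE'
  have hEm : MeasurableSet E := measurableSet_ball.inter measurableSet_ball
  have hEm' : MeasurableSet E' := measurableSet_ball.inter measurableSet_ball
  set Φ : ℂ → ENNReal := fun z => ∫⁻ w in E' ∩ {w | (z, w) ∈ R}, density h p (m - 2) w with hΦ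
  set Q : ℂ → ENNReal := fun z => ENNReal.ofReal (C * δ ^ (-(a + 1) / 2)) + Φ z with hQ
  have radial : ∀ z ∈ E, ∀ s ∈ Icc (0 : ℝ) 1,
      ENNReal.ofReal (‖h (s * z)‖ ^ p * (1 - s * ‖z‖) ^ m) ≤ ENNReal.ofReal K₃ * Q z := by
    rintro z ⟨hz1, hz⟩ s hs
    obtain ⟨hsz, hn⟩ := smul_mem_unitDisk hz hs
    have hpos : 0 < 1 - s * ‖z‖ := by rw [mem_unitDisk, hn] at hsz; linarith
    rcases le_or_gt δ (1 - s * ‖z‖) with hcase | hcase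
    · have h1 := hpt h hh C hC hcb _ hsz
      rw [hn] at h1
      have h2 : (1 - s * ‖z‖) ^ m =
          (1 - s * ‖z‖) ^ (a + p + 1) * (1 - s * ‖z‖) ^ (-(a + 1) / 2) := by
        rw [← Real.rpow_add hpos, hm']; congr 1; ring
      have h3 : (1 - s * ‖z‖) ^ (-(a + 1) / 2) ≤ δ ^ (-(a + 1) / 2) :=
        Real.rpow_le_rpow_of_nonpos hδ hcase (by linarith)
      calc ENNReal.ofReal (‖h (s * z)‖ ^ p * (1 - s * ‖z‖) ^ m)
          ≤ ENNReal.ofReal (K₃ * (C * δ ^ (-(a + 1) / 2))) := by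
            refine ENNReal.ofReal_le_ofReal ?_
            rw [h2, ← mul_assoc]
            refine (mul_le_mul h1 h3 (by positivity) (by positivity)).trans ?_
            rw [mul_assoc]
            gcongr
            linarith
        _ = ENNReal.ofReal K₃ * ENNReal.ofReal (C * δ ^ (-(a + 1) / 2)) :=
            ENNReal.ofReal_mul hK₃pos.le
        _ ≤ _ := mul_le_mul_right le_self_add _
    · have h1 := hloc h hh _ hsz
      rw [hn] at h1
      refine h1.trans ?_
      refine mul_le_mul' (ENNReal.ofReal_le_ofReal (by linarith)) ?_
      refine le_trans (lintegral_mono_set fun w hw => ?_) le_add_self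
      have hwb : w ∈ ball ((s : ℂ) * z) ((1 - ‖(s : ℂ) * z‖) / 2) := by rw [hn]; exact hw
      obtain ⟨h2, h3, h4⟩ := one_sub_norm_bounds hwb
      have hwD := closedBall_subset_unitDisk hsz (ball_subset_closedBall hwb)
      rw [mem_ball, dist_eq_norm, hn] at hwb
      rw [hn] at h2 h3
      rw [mem_ball, dist_eq_norm] at hz1
      have h5 : ‖(s : ℂ) * z - z‖ ≤ 1 - s * ‖z‖ := by
        have : (s : ℂ) * z - z = ((s - 1 : ℝ) : ℂ) * z := by push_cast; ring
        rw [this, norm_mul, Complex.norm_real, Real.norm_of_nonpos (by linarith [hs.2])]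
        rw [mem_unitDisk] at hz
        nlinarith [hs.1, hs.2, norm_nonneg z]
      have h6 := norm_sub_le_norm_sub_add_norm_sub w ((s : ℂ) * z) z
      have h7 := norm_sub_le_norm_sub_add_norm_sub w z ξ
      refine ⟨⟨?_, hwD⟩, ?_⟩
      · rw [mem_ball, dist_eq_norm]; linarith
      · show ‖w - z‖ < 3 * (1 - ‖w‖)
        linarith
  have primitive : ∀ z ∈ E, ENNReal.ofReal (‖AnalyticTent.integrationOp h z‖ ^ p *
      (1 - ‖z‖) ^ (ε * p)) ≤ ENNReal.ofReal (K₃ / ε ^ p) * Q z := by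
    intro z hzE
    have hz := hzE.2
    have hz' : 0 < 1 - ‖z‖ := by rw [mem_unitDisk] at hz; linarith
    rcases eq_or_ne (Q z) ⊤ with hT | hT
    · rw [hT, ENNReal.mul_top (by simp; positivity)]; exact le_top
    obtain ⟨q, hq⟩ : ∃ q : NNReal, Q z = q := ⟨(Q z).toNNReal, (ENNReal.coe_toNNReal hT).symm⟩
    have hrad := radial z hzE
    rw [hq, ← ENNReal.ofReal_coe_nnreal, ← ENNReal.ofReal_mul hK₃pos.le] at hrad
    have hb2 : ∀ s ∈ Icc (0 : ℝ) 1, ‖h (s * z)‖ ≤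
        (K₃ * q) ^ (1 / p) * (1 - s * ‖z‖) ^ (-1 - ε) := by
      intro s hs
      obtain ⟨hsz, hn⟩ := smul_mem_unitDisk hz hs
      have hpos : 0 < 1 - s * ‖z‖ := by rw [mem_unitDisk, hn] at hsz; linarith
      have h1 := (ENNReal.ofReal_le_ofReal_iff (by positivity)).1 (hrad s hs)
      rw [← Real.rpow_le_rpow_iff (norm_nonneg _) (by positivity) hp,
        Real.mul_rpow (by positivity) (by positivity), ← Real.rpow_mul (by positivity),
        one_div_mul_cancel hp.ne', Real.rpow_one, ← Real.rpow_mul hpos.le,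
        show (-1 - ε) * p = -m by rw [hm]; ring, Real.rpow_neg hpos.le, ← div_eq_mul_inv,
        le_div_iff₀ (by positivity)]
      exact h1
    have h3 := norm_integrationOp_le hz (by positivity) hεpos hb2
    rw [hq, ← ENNReal.ofReal_coe_nnreal, ← ENNReal.ofReal_mul (by positivity)]
    refine ENNReal.ofReal_le_ofReal ?_
    calc ‖AnalyticTent.integrationOp h z‖ ^ p * (1 - ‖z‖) ^ (ε * p)
        ≤ ((K₃ * q) ^ (1 / p) / ε * (1 - ‖z‖) ^ (-ε)) ^ p * (1 - ‖z‖) ^ (ε * p) := by gcongr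
      _ = _ := by
        rw [Real.mul_rpow (by positivity) (by positivity), Real.div_rpow (by positivity)
          hεpos.le, ← Real.rpow_mul (by positivity), one_div_mul_cancel hp.ne', Real.rpow_one,
          ← Real.rpow_mul hz'.le, mul_assoc, ← Real.rpow_add hz']
        simp only [neg_mul, neg_add_cancel, Real.rpow_zero]
        ring
  have step1 : ∀ z ∈ E, density (AnalyticTent.integrationOp h) p a z ≤
      ENNReal.ofReal (K₃ / ε ^ p) *
        (v z * ENNReal.ofReal (C * δ ^ (-(a + 1) / 2)) + v z * Φ z) := by
    intro z hz
    refine (density_le_mul_of_le hz.2 (primitive z hz)).trans (le_of_eq ?_)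
    rw [mul_left_comm, ← mul_add, show a - ε * p = b by rw [hεp, hb]; ring]
  -- The admissible `z` lie within `4 * (1 - ‖w‖)` of the boundary point nearest `w`; their weight
  -- contributes exponent `b + 2`, and `m - 2 + (b + 2) = a + p`.
  have step2 : ∀ w ∈ E', density h p (m - 2) w * ∫⁻ z in E ∩ {z | (z, w) ∈ R}, v z ≤
      ENNReal.ofReal (W * 4 ^ (b + 2)) * density h p (a + p) w := by
    rintro w ⟨-, hw⟩
    have hw' : 0 < 1 - ‖w‖ := by rw [mem_unitDisk] at hw; linarith
    obtain ⟨η, hη, hwη⟩ := exists_norm_eq_one_norm_sub w hw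
    have h1 : ∫⁻ z in E ∩ {z | (z, w) ∈ R}, v z ≤
        ENNReal.ofReal (W * (4 * (1 - ‖w‖)) ^ (b + 2)) := by
      refine (lintegral_mono_set fun z hz => ?_).trans
        (weight_ball_le hb1 hη (by linarith : 0 < 4 * (1 - ‖w‖)))
      have hz2 : ‖w - z‖ < 3 * (1 - ‖w‖) := hz.2
      refine ⟨?_, hz.1.2⟩
      rw [mem_ball, dist_eq_norm]
      have := norm_sub_le_norm_sub_add_norm_sub z w η
      rw [norm_sub_rev z w] at this
      linarith
    refine (mul_le_mul_right h1 _).trans (le_of_eq ?_)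
    rw [density, density, ← ENNReal.ofReal_mul (by positivity),
      ← ENNReal.ofReal_mul (by positivity), Real.mul_rpow (by norm_num) hw'.le,
      show a + p = (m - 2) + (b + 2) by rw [hm', hb]; ring, Real.rpow_add hw' (m - 2)]
    congr 1; ring
  calc ∫⁻ z in E, density (AnalyticTent.integrationOp h) p a z
      ≤ ∫⁻ z in E, ENNReal.ofReal (K₃ / ε ^ p) *
          (v z * ENNReal.ofReal (C * δ ^ (-(a + 1) / 2)) + v z * Φ z) :=
        setLIntegral_mono' hEm step1
    _ = ENNReal.ofReal (K₃ / ε ^ p) * ((∫⁻ z in E, v z) * ENNReal.ofReal (C * δ ^ (-(a + 1) / 2)) +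
          ∫⁻ w in E', density h p (m - 2) w * ∫⁻ z in E ∩ {z | (z, w) ∈ R}, v z) := by
        rw [lintegral_const_mul' _ _ ENNReal.ofReal_ne_top, lintegral_add_left (by fun_prop),
          lintegral_mul_const _ (by fun_prop), setLIntegral_mul_setLIntegral_swap hRm (by fun_prop)
            (aemeasurable_density hh hp _ inter_subset_right)]
    _ ≤ ENNReal.ofReal (K₃ / ε ^ p) * (ENNReal.ofReal (W * δ ^ (b + 2)) *
          ENNReal.ofReal (C * δ ^ (-(a + 1) / 2)) +
          ENNReal.ofReal (W * 4 ^ (b + 2)) * ENNReal.ofReal (C * (3 * δ))) := by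
        refine mul_le_mul_right (add_le_add (mul_le_mul_left (weight_ball_le hb1 hξ hδ) _) ?_) _
        refine (setLIntegral_mono' hEm' step2).trans ?_
        rw [lintegral_const_mul' _ _ ENNReal.ofReal_ne_top]
        exact mul_le_mul_right (hcb ξ hξ _ (by positivity)) _
    _ = _ := by
        rw [← ENNReal.ofReal_mul (by positivity), ← ENNReal.ofReal_mul (by positivity),
          ← ENNReal.ofReal_add (by positivity) (by positivity), ← ENNReal.ofReal_mul (by positivity)]
        have : δ ^ (b + 2) * δ ^ (-(a + 1) / 2) = δ := by
          rw [← Real.rpow_add hδ, hb, show (a - 1) / 2 + 2 + -(a + 1) / 2 = 1 by ring, Real.rpow_one]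
        congr 1
        rw [mul_mul_mul_comm W, this]
        ring

lemma CarlesonBound.iterate_integrationOp {p : ℝ} (hp : 0 < p) {a : ℝ} (ha : -1 < a) (n : ℕ) :
    ∃ K : ℝ, 0 < K ∧ ∀ h ∈ holo, ∀ C : ℝ, 0 ≤ C → CarlesonBound h p (a + n * p) C →
      CarlesonBound (AnalyticTent.integrationOp^[n] h) p a (K * C) := by
  induction n with
  | zero => exact ⟨1, one_pos, fun f _ C _ hb => by simpa using hb⟩
  | succ n ih =>
    obtain ⟨K, hK, h⟩ := ih
    obtain ⟨K', hK', h'⟩ := CarlesonBound.integrationOp hp (a := a + n * p)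
      (by have : 0 ≤ n * p := by positivity
          linarith)
    refine ⟨K * K', by positivity, fun f hf C hC hb => ?_⟩
    rw [Function.iterate_succ_apply, mul_assoc]
    refine h _ (integrationOp_mem_holo hf) _ (by positivity) (h' f hf C hC ?_)
    convert hb using 1
    push_cast; ring

/-! ### Equivalence of the tent norm with a Carleson bound -/

/-- For holomorphic functions it is enough to test the Carleson condition on small balls. -/
lemma carlesonBound_of_small {p : ℝ} (hp : 0 < p) (a : ℝ) {δ₁ : ℝ} (hδ₁ : 0 < δ₁) (hδ₁' : δ₁ ≤ 1) :
    ∃ K : ℝ, 0 < K ∧ ∀ f ∈ holo, ∀ C : ℝ, 0 ≤ C →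
      (∀ ξ : ℂ, ‖ξ‖ = 1 → ∀ δ : ℝ, 0 < δ → δ ≤ δ₁ →
        ∫⁻ z in ball ξ δ ∩ unitDisk, density f p a z ≤ ENNReal.ofReal (C * δ)) →
      CarlesonBound f p a (K * C) := by
  obtain ⟨K₁, hK₁, hpt⟩ := pointwise_of_ball_bound hp a
  obtain ⟨t, ht, hcover⟩ := (isCompact_sphere (0 : ℂ) 1).elim_nhds_subcover
    (fun ξ => ball ξ (δ₁ / 2)) (fun ξ _ => ball_mem_nhds ξ (by positivity))
  set A : ℝ := K₁ * (δ₁ / 2) ^ (-(a + 1)) with hA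
  set M : ℝ := (2 / δ₁) ^ |a| with hM
  have hpi := Real.pi_pos
  set N : ℝ := A * M * Real.pi + t.card * δ₁ with hN
  have hNpos : 0 < N := by positivity
  refine ⟨N / δ₁ + 1, by positivity, fun f hf C hC hsmall ξ hξ δ hδ => ?_⟩
  rcases le_or_gt δ δ₁ with hle | hlt
  · refine (hsmall ξ hξ δ hδ hle).trans (ENNReal.ofReal_le_ofReal ?_)
    have : 0 ≤ N / δ₁ * C * δ := by positivity
    nlinarith
  -- At this modulus `2 * (1 - ‖z‖) = δ₁`, the largest radius covered by the assumption. The maximum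
  -- principle carries the bound inside, and finitely many balls of radius `δ₁` cover the remaining
  -- annulus.
  have hsphere : ∀ z : ℂ, ‖z‖ = 1 - δ₁ / 2 → ‖f z‖ ≤ (A * C) ^ (1 / p) := by
    intro z hz
    have h1 := hpt f hf z (by rw [mem_unitDisk, hz]; linarith) C hC (fun ξ hξ => by
      rw [hz, show 2 * (1 - (1 - δ₁ / 2)) = δ₁ by ring]
      exact hsmall ξ hξ δ₁ hδ₁ le_rfl)
    rw [hz, sub_sub_cancel] at h1
    rw [one_div, Real.le_rpow_inv_iff_of_pos (norm_nonneg _) (by positivity) hp, hA,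
      Real.rpow_neg (by positivity), mul_right_comm, ← div_eq_mul_inv, le_div_iff₀ (by positivity)]
    exact h1
  have hinner : ∀ z ∈ closedBall (0 : ℂ) (1 - δ₁ / 2), ‖f z‖ ≤ (A * C) ^ (1 / p) := by
    intro z hz
    have hr : (1 - δ₁ / 2) ≠ 0 := by linarith
    refine Complex.norm_le_of_forall_mem_frontier_norm_le (U := ball (0 : ℂ) (1 - δ₁ / 2))
      isBounded_ball ?_ (fun w hw => ?_) (by rwa [closure_ball _ hr])
    · exact (hf.mono (closedBall_subset_ball (by linarith))).diffContOnCl_ball subset_rfl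
    · rw [frontier_ball _ hr, mem_sphere_zero_iff_norm] at hw
      exact hsphere w hw
  have hI : ∫⁻ z in closedBall (0 : ℂ) (1 - δ₁ / 2), density f p a z ≤
      ENNReal.ofReal (A * M * Real.pi * C) := by
    have h1 : ∀ z ∈ closedBall (0 : ℂ) (1 - δ₁ / 2),
        density f p a z ≤ ENNReal.ofReal (A * C * M) := by
      intro z hz
      have h2 := hinner z hz
      rw [mem_closedBall_zero_iff] at hz
      refine ENNReal.ofReal_le_ofReal (mul_le_mul ?_ ?_ ?_ (by positivity))
      · refine (Real.rpow_le_rpow (norm_nonneg _) h2 hp.le).trans_eq ?_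
        rw [← Real.rpow_mul (by positivity), one_div_mul_cancel hp.ne', Real.rpow_one]
      · have h3 : 1 ≤ 2 / δ₁ := by rw [le_div_iff₀ hδ₁]; linarith
        have := rpow_le_of_comparable a (by linarith : 0 < 1 - ‖z‖) one_pos h3
          (by linarith [norm_nonneg z]) (by
            rw [div_mul_eq_mul_div, le_div_iff₀ hδ₁]; linarith)
        simpa using this
      · exact Real.rpow_nonneg (by linarith) _
    refine (setLIntegral_mono' measurableSet_closedBall h1).trans ?_
    rw [setLIntegral_const]
    have hv : volume (closedBall (0 : ℂ) (1 - δ₁ / 2)) ≤ ENNReal.ofReal Real.pi := by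
      refine (measure_mono (closedBall_subset_ball (by linarith : 1 - δ₁ / 2 < 1))).trans ?_
      rw [Complex.volume_ball, ← NNReal.coe_real_pi, ENNReal.ofReal_coe_nnreal]
      simp
    refine (mul_le_mul_right hv _).trans (le_of_eq ?_)
    rw [← ENNReal.ofReal_mul (by positivity)]
    congr 1; ring
  have hsub : unitDisk ⊆ closedBall (0 : ℂ) (1 - δ₁ / 2) ∪ ⋃ η : t, ball (η : ℂ) δ₁ ∩ unitDisk := by
    intro z hz
    rcases le_or_gt ‖z‖ (1 - δ₁ / 2) with h | h
    · exact Or.inl (mem_closedBall_zero_iff.2 h)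
    obtain ⟨η, hη, hzη⟩ := exists_norm_eq_one_norm_sub z hz
    obtain ⟨η', hη', hd⟩ := mem_iUnion₂.1 (hcover (mem_sphere_zero_iff_norm.2 hη))
    refine Or.inr (mem_iUnion.2 ⟨⟨η', hη'⟩, ?_, hz⟩)
    rw [mem_ball, dist_eq_norm] at hd ⊢
    have := norm_sub_le_norm_sub_add_norm_sub z η η'
    linarith
  have hfin : ∫⁻ z in ⋃ η : t, ball (η : ℂ) δ₁ ∩ unitDisk, density f p a z ≤
      ENNReal.ofReal (t.card * δ₁ * C) := by
    refine (lintegral_iUnion_le _ _).trans ?_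
    rw [tsum_fintype]
    refine (Finset.sum_le_card_nsmul _ _ (ENNReal.ofReal (C * δ₁)) fun η _ => ?_).trans ?_
    · exact hsmall η (mem_sphere_zero_iff_norm.1 (ht η η.2)) δ₁ hδ₁ le_rfl
    · rw [Finset.card_univ, Fintype.card_coe, ← ENNReal.ofReal_nsmul, nsmul_eq_mul]
      exact ENNReal.ofReal_le_ofReal (le_of_eq (by ring))
  calc ∫⁻ z in ball ξ δ ∩ unitDisk, density f p a z
      ≤ ∫⁻ z in closedBall (0 : ℂ) (1 - δ₁ / 2) ∪ ⋃ η : t, ball (η : ℂ) δ₁ ∩ unitDisk,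
          density f p a z := lintegral_mono_set (inter_subset_right.trans hsub)
    _ ≤ ENNReal.ofReal (A * M * Real.pi * C) + ENNReal.ofReal (t.card * δ₁ * C) :=
        (lintegral_union_le _ _ _).trans (add_le_add hI hfin)
    _ = ENNReal.ofReal (N * C) := by
        rw [← ENNReal.ofReal_add (by positivity) (by positivity), ← add_mul]
    _ ≤ _ := by
        refine ENNReal.ofReal_le_ofReal ?_
        have h1 : N * C ≤ N / δ₁ * C * δ := by
          rw [div_mul_eq_mul_div, div_mul_eq_mul_div, le_div_iff₀ hδ₁]
          gcongr
        nlinarith [mul_nonneg hC hδ.le]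

lemma one_sub_norm_sq_bounds {z : ℂ} (hz : z ∈ unitDisk) :
    0 < 1 - ‖z‖ ∧ 0 < 1 - ‖z‖ ^ 2 ∧ 1 - ‖z‖ ≤ 1 - ‖z‖ ^ 2 ∧ 1 - ‖z‖ ^ 2 ≤ 2 * (1 - ‖z‖) := by
  rw [mem_unitDisk] at hz
  have := norm_nonneg z
  refine ⟨?_, ?_, ?_, ?_⟩ <;> nlinarith

lemma one_sub_norm_sq_rpow_le (a : ℝ) {z : ℂ} (hz : z ∈ unitDisk) :
    (1 - ‖z‖ ^ 2) ^ a ≤ 2 ^ |a| * (1 - ‖z‖) ^ a := by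
  obtain ⟨h1, h2, h3, h4⟩ := one_sub_norm_sq_bounds hz
  exact rpow_le_of_comparable a h2 h1 one_le_two h4 (by linarith)

lemma one_sub_norm_rpow_le (a : ℝ) {z : ℂ} (hz : z ∈ unitDisk) :
    (1 - ‖z‖) ^ a ≤ 2 ^ |a| * (1 - ‖z‖ ^ 2) ^ a := by
  obtain ⟨h1, h2, h3, h4⟩ := one_sub_norm_sq_bounds hz
  exact rpow_le_of_comparable a h1 h2 one_le_two (by linarith) h4

lemma enorm_rpow_mul_eq (f : ℂ → ℂ) {p : ℝ} (hp : 0 < p) (z : ℂ) (x : ℝ) :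
    ‖f z‖ₑ ^ p * ENNReal.ofReal x = ENNReal.ofReal (‖f z‖ ^ p * x) := by
  rw [← ofReal_norm, ENNReal.ofReal_rpow_of_nonneg (norm_nonneg _) hp.le,
    ENNReal.ofReal_mul (by positivity)]

lemma tentNorm_integrand_le (f : ℂ → ℂ) {p : ℝ} (hp : 0 < p) (a : ℝ) {z : ℂ} (hz : z ∈ unitDisk) :
    ‖f z‖ₑ ^ p * ENNReal.ofReal ((1 - ‖z‖ ^ 2) ^ a) ≤ ENNReal.ofReal (2 ^ |a|) * density f p a z := by
  rw [enorm_rpow_mul_eq f hp, density, ← ENNReal.ofReal_mul (by positivity)]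
  refine ENNReal.ofReal_le_ofReal ?_
  rw [mul_left_comm]
  exact mul_le_mul_of_nonneg_left (one_sub_norm_sq_rpow_le a hz) (by positivity)

lemma density_le_tentNorm_integrand (f : ℂ → ℂ) {p : ℝ} (hp : 0 < p) (a : ℝ) {z : ℂ}
    (hz : z ∈ unitDisk) : density f p a z ≤
      ENNReal.ofReal (2 ^ |a|) * (‖f z‖ₑ ^ p * ENNReal.ofReal ((1 - ‖z‖ ^ 2) ^ a)) := by
  rw [enorm_rpow_mul_eq f hp, density, ← ENNReal.ofReal_mul (by positivity)]
  refine ENNReal.ofReal_le_ofReal ?_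
  rw [mul_left_comm]
  exact mul_le_mul_of_nonneg_left (one_sub_norm_rpow_le a hz) (by positivity)

lemma norm_exp_sub_exp_le (s t : ℝ) :
    ‖Complex.exp (s * Complex.I) - Complex.exp (t * Complex.I)‖ ≤ |s - t| := by
  have : Complex.exp (s * Complex.I) - Complex.exp (t * Complex.I) =
      Complex.exp (t * Complex.I) * (Complex.exp (Complex.I * ((s - t : ℝ) : ℂ)) - 1) := by
    rw [mul_sub, ← Complex.exp_add, mul_one]
    congr 2; push_cast; ring
  rw [this, norm_mul, Complex.norm_exp_ofReal_mul_I, one_mul]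
  exact Real.norm_exp_I_mul_ofReal_sub_one_le

lemma exists_carlesonBox_subset {u : ℂ} (hu : u ∈ unitDisk) :
    ∃ ξ : ℂ, ‖ξ‖ = 1 ∧ carlesonBox u ⊆ ball ξ (3 * (1 - ‖u‖)) ∩ unitDisk := by
  have hu' : 0 < 1 - ‖u‖ := (one_sub_norm_sq_bounds hu).1
  rcases eq_or_ne u 0 with rfl | h0
  · refine ⟨1, by simp, ?_⟩
    rw [carlesonBox, if_pos rfl]
    refine fun z hz => ⟨?_, hz⟩
    rw [mem_unitDisk] at hz
    rw [mem_ball, dist_eq_norm]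
    have := norm_sub_le z 1
    simp only [norm_one, norm_zero] at *
    linarith
  refine ⟨Complex.exp (Complex.arg u * Complex.I), Complex.norm_exp_ofReal_mul_I _, ?_⟩
  rw [carlesonBox, if_neg h0]
  rintro z ⟨hz, l, t, rfl, ht, hl⟩
  refine ⟨?_, hz⟩
  rw [mem_unitDisk, norm_mul, Complex.norm_exp_ofReal_mul_I, mul_one, Complex.norm_real] at hz
  have hl1 : l < 1 := (le_abs_self l).trans_lt hz
  rw [mem_ball, dist_eq_norm]
  have h1 := norm_sub_le_norm_sub_add_norm_sub ((l : ℂ) * Complex.exp (t * Complex.I))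
    (Complex.exp (t * Complex.I)) (Complex.exp (Complex.arg u * Complex.I))
  have h2 := norm_exp_sub_exp_le t (Complex.arg u)
  have h3 : ‖(l : ℂ) * Complex.exp (t * Complex.I) - Complex.exp (t * Complex.I)‖ = 1 - l := by
    rw [← sub_one_mul, norm_mul, Complex.norm_exp_ofReal_mul_I, mul_one, ← Complex.ofReal_one,
      ← Complex.ofReal_sub, Complex.norm_real, Real.norm_of_nonpos (by linarith)]
    ring
  linarith

lemma setLIntegral_areaMeasure (s : Set ℂ) (φ : ℂ → ENNReal) :
    ∫⁻ z in s, φ z ∂areaMeasure = (ENNReal.ofReal Real.pi)⁻¹ * ∫⁻ z in s, φ z := by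
  rw [areaMeasure, setLIntegral_smul_measure, smul_eq_mul]

lemma CarlesonBound.tentNorm_le {p : ℝ} (hp : 0 < p) (ζ α : ℝ) : ∃ K : ℝ, 0 < K ∧
    ∀ (f : ℂ → ℂ) (C : ℝ), 0 ≤ C → CarlesonBound f p (α + 1) C →
      tentNorm ζ p α f ≤ ENNReal.ofReal ((K * C) ^ (1 / p)) := by
  refine ⟨2 ^ |α + 1| * 3, by positivity, fun f C hC hb => ?_⟩
  refine essSup_le_of_ae_le _ (Filter.Eventually.of_forall fun θ => ?_)
  rw [← ENNReal.ofReal_rpow_of_nonneg (by positivity) (by positivity)]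
  refine ENNReal.rpow_le_rpow (iSup₂_le fun u hu => ?_) (by positivity)
  obtain ⟨h1, h2, h3, -⟩ := one_sub_norm_sq_bounds hu.1
  obtain ⟨ξ, hξ, hsub⟩ := exists_carlesonBox_subset hu.1
  rw [setLIntegral_areaMeasure]
  have hpi : (ENNReal.ofReal Real.pi)⁻¹ ≤ 1 := by
    rw [ENNReal.inv_le_one, ENNReal.one_le_ofReal]
    linarith [Real.pi_gt_three]
  have hint : ∫⁻ z in carlesonBox u, ‖f z‖ₑ ^ p * ENNReal.ofReal ((1 - ‖z‖ ^ 2) ^ (α + 1)) ≤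
      ENNReal.ofReal (2 ^ |α + 1|) * ENNReal.ofReal (C * (3 * (1 - ‖u‖))) := by
    refine (lintegral_mono_set hsub).trans ?_
    refine (setLIntegral_mono' (measurableSet_ball.inter measurableSet_ball)
      fun z hz => tentNorm_integrand_le f hp (α + 1) hz.2).trans ?_
    rw [lintegral_const_mul' _ _ ENNReal.ofReal_ne_top]
    exact mul_le_mul_right (hb ξ hξ _ (by positivity)) _
  refine (mul_le_mul_right ((mul_le_mul' hpi hint).trans_eq (one_mul _)) _).trans ?_
  rw [← ENNReal.ofReal_mul (by positivity), ← ENNReal.ofReal_mul (by positivity)]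
  refine ENNReal.ofReal_le_ofReal ?_
  rw [one_div, inv_mul_le_iff₀ h2]
  have : 0 ≤ 2 ^ |α + 1| * C * 3 := by positivity
  nlinarith

/-- The condition on `‖u‖` says that `u` lies in the region at its own radial projection. By
openness it then lies in the regions of a set of `η` of positive measure, so the essential supremum
dominates the average over this box. -/
lemma carlesonBox_integral_le_tentNorm {ζ p α : ℝ} (hζ : 1 / 2 < ζ) (hp : 0 < p) (f : ℂ → ℂ)
    {u : ℂ} (hu : u ∈ unitDisk) (huζ : 1 / ζ - 1 < ‖u‖) :
    ENNReal.ofReal (1 / (1 - ‖u‖ ^ 2)) * ∫⁻ z in carlesonBox u,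
      ‖f z‖ₑ ^ p * ENNReal.ofReal ((1 - ‖z‖ ^ 2) ^ (α + 1)) ∂areaMeasure ≤
      tentNorm ζ p α f ^ p := by
  obtain ⟨h1, h2, -, -⟩ := one_sub_norm_sq_bounds hu
  set s : Set ℝ := {θ | ‖u - Complex.exp (θ * Complex.I)‖ < ζ * (1 - ‖u‖ ^ 2)} with hs
  have hsopen : IsOpen s := isOpen_lt (by fun_prop) (by fun_prop)
  have harg : Complex.arg u ∈ s := by
    have h3 : u - Complex.exp (Complex.arg u * Complex.I) =
        ((‖u‖ - 1 : ℝ) : ℂ) * Complex.exp (Complex.arg u * Complex.I) := by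
      push_cast
      linear_combination -Complex.norm_mul_exp_arg_mul_I u
    rw [hs, mem_ofPred_eq, h3, norm_mul, Complex.norm_exp_ofReal_mul_I, mul_one, Complex.norm_real,
      Real.norm_of_nonpos (by linarith)]
    rw [sub_lt_iff_lt_add, div_lt_iff₀ (by linarith)] at huζ
    nlinarith
  -- The argument may equal `π`, the end of the parameter interval, so interior parameters are
  -- reached by closure.
  have hne : (s ∩ Ioo (-Real.pi) Real.pi).Nonempty := by
    have hcl : Complex.arg u ∈ closure (Ioo (-Real.pi) Real.pi) := by
      rw [closure_Ioo (by linarith [Real.pi_pos])]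
      exact ⟨(Complex.neg_pi_lt_arg u).le, Complex.arg_le_pi u⟩
    exact mem_closure_iff.1 hcl s hsopen harg
  have hpos : (volume.restrict (Ioc (-Real.pi) Real.pi)) s ≠ 0 := by
    rw [Measure.restrict_apply hsopen.measurableSet]
    refine ne_of_gt (lt_of_lt_of_le ((hsopen.inter isOpen_Ioo).measure_pos volume hne) ?_)
    exact measure_mono (inter_subset_inter_right _ Ioo_subset_Ioc_self)
  obtain ⟨θ, hθ, hle⟩ := ((frequently_ae_mem_iff.2 hpos).and_eventually
    (ENNReal.ae_le_essSup (fun θ : ℝ =>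
      (⨆ u ∈ nonTangential ζ (Complex.exp (θ * Complex.I)),
        ENNReal.ofReal (1 / (1 - ‖u‖ ^ 2)) * ∫⁻ z in carlesonBox u,
          ‖f z‖ₑ ^ p * ENNReal.ofReal ((1 - ‖z‖ ^ 2) ^ (α + 1)) ∂areaMeasure) ^ (1 / p)))).exists
  simp only [one_div p, ENNReal.rpow_inv_le_iff hp] at hle
  refine le_trans (le_iSup₂_of_le u ⟨hu, hθ⟩ le_rfl) (hle.trans_eq ?_)
  rw [tentNorm, one_div p]

/-- Radial projection of `z` lands within `2 * δ` of `ξ`, hence at angle at most `π * δ ≤ 4 * δ`,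
the half-width of the box at depth `8 * δ`. -/
lemma ball_inter_subset_carlesonBox {ξ : ℂ} (hξ : ‖ξ‖ = 1) {δ : ℝ} (hδ : 0 < δ) (hδ' : 8 * δ < 1) :
    ball ξ δ ∩ unitDisk ⊆ carlesonBox (((1 - 8 * δ : ℝ) : ℂ) * ξ) := by
  set u : ℂ := ((1 - 8 * δ : ℝ) : ℂ) * ξ with hu
  have hpos : 0 < 1 - 8 * δ := by linarith
  have hun : ‖u‖ = 1 - 8 * δ := by
    rw [hu, norm_mul, hξ, mul_one, Complex.norm_real, Real.norm_of_nonneg hpos.le]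
  have hu0 : u ≠ 0 := by rw [← norm_pos_iff, hun]; exact hpos
  rintro z ⟨hz, hzD⟩
  rw [mem_ball, dist_eq_norm] at hz
  rw [carlesonBox, if_neg hu0, hun]
  have hz1 : 1 - ‖z‖ < δ := by
    have := norm_sub_norm_le ξ z
    rw [hξ, norm_sub_rev] at this
    linarith
  have hzpos : 0 < ‖z‖ := by linarith
  have hz0 : z ≠ 0 := norm_pos_iff.1 hzpos
  have hζ0 : (‖z‖ : ℂ) ≠ 0 := by exact_mod_cast hzpos.ne'
  have hξ0 : ξ ≠ 0 := norm_pos_iff.1 (by rw [hξ]; exact one_pos)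
  have hexp : Complex.exp (Complex.arg u * Complex.I) = ξ := by
    have h1 := Complex.norm_mul_exp_arg_mul_I u
    rw [hun] at h1
    refine mul_left_cancel₀ (a := ((1 - 8 * δ : ℝ) : ℂ)) ?_ h1
    exact_mod_cast hpos.ne'
  set η : ℂ := z / ‖z‖ with hη
  have hη1 : ‖η‖ = 1 := by simp [hη, hz0]
  have hzη : z = ‖z‖ * η := by rw [hη]; field_simp
  have hηξ : ‖η - ξ‖ ≤ 2 * δ := by
    have h2 := norm_sub_le_norm_sub_add_norm_sub η z ξ
    have h3 : ‖η - z‖ = 1 - ‖z‖ := by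
      have : η - z = ((1 - ‖z‖ : ℝ) : ℂ) * η := by
        push_cast
        linear_combination -hzη
      rw [this, norm_mul, hη1, mul_one, Complex.norm_real, Real.norm_of_nonneg]
      exact (one_sub_norm_sq_bounds hzD).1.le
    linarith
  have hang := Complex.angle_le_mul_norm_sub hη1 hξ
  rw [Complex.angle_eq_abs_arg (norm_pos_iff.1 (by rw [hη1]; exact one_pos)) hξ0] at hang
  refine ⟨hzD, ‖z‖, Complex.arg u + Complex.arg (η / ξ), ?_, ?_, by linarith⟩
  · have h4 := Complex.norm_mul_exp_arg_mul_I (η / ξ)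
    rw [norm_div, hη1, hξ, div_one, Complex.ofReal_one, one_mul] at h4
    push_cast
    rw [add_mul, Complex.exp_add, hexp, h4, mul_div_cancel₀ _ hξ0, ← hzη]
  · rw [add_sub_cancel_left]
    have := Real.pi_le_four
    nlinarith [norm_nonneg (η - ξ)]

lemma carlesonBound_of_tentNorm {ζ p : ℝ} (hζ : 1 / 2 < ζ) (hp : 0 < p) (α : ℝ) :
    ∃ K : ℝ, 0 < K ∧ ∀ f ∈ holo, tentNorm ζ p α f < ⊤ →
      CarlesonBound f p (α + 1) (K * (tentNorm ζ p α f).toReal ^ p) := by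
  have hζ0 : 0 < ζ := by linarith
  have hζ1 : 1 / ζ < 2 := by rw [div_lt_iff₀ hζ0]; linarith
  have hpi := Real.pi_pos
  -- For `δ ≤ δ₁` the centre `u` of modulus `1 - 8 * δ` satisfies `‖u‖ > 1 / ζ - 1` and is nonzero.
  -- Positivity of the first entry is where `ζ > 1 / 2` is needed.
  set δ₁ : ℝ := min ((2 - 1 / ζ) / 16) (1 / 16) with hδ₁
  have hδ₁pos : 0 < δ₁ := lt_min (by linarith) (by norm_num)
  have hδ₁a : δ₁ ≤ (2 - 1 / ζ) / 16 := min_le_left _ _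
  have hδ₁b : δ₁ ≤ 1 / 16 := min_le_right _ _
  obtain ⟨K, hK, h⟩ := carlesonBound_of_small hp (α + 1) hδ₁pos (by linarith)
  refine ⟨K * (2 ^ |α + 1| * Real.pi * 16), by positivity, fun f hf hfin => ?_⟩
  rw [mul_assoc]
  refine h f hf _ (by positivity) fun ξ hξ δ hδ hle => ?_
  set u : ℂ := ((1 - 8 * δ : ℝ) : ℂ) * ξ with hu
  have hpos : 0 < 1 - 8 * δ := by linarith
  have hun : ‖u‖ = 1 - 8 * δ := by
    rw [hu, norm_mul, hξ, mul_one, Complex.norm_real, Real.norm_of_nonneg hpos.le]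
  have huD : u ∈ unitDisk := by rw [mem_unitDisk, hun]; linarith
  obtain ⟨h1, h2, -, h4⟩ := one_sub_norm_sq_bounds huD
  have hbox := carlesonBox_integral_le_tentNorm (α := α) hζ hp f huD (by rw [hun]; linarith)
  rw [setLIntegral_areaMeasure] at hbox
  set X := ∫⁻ z in carlesonBox u, ‖f z‖ₑ ^ p * ENNReal.ofReal ((1 - ‖z‖ ^ 2) ^ (α + 1)) with hX
  set T : ℝ := (tentNorm ζ p α f).toReal with hT
  have hTe : tentNorm ζ p α f ^ p = ENNReal.ofReal (T ^ p) := by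
    rw [← ENNReal.ofReal_rpow_of_nonneg ENNReal.toReal_nonneg hp.le,
      ENNReal.ofReal_toReal hfin.ne]
  rw [hTe] at hbox
  have hXle : X ≤ ENNReal.ofReal (Real.pi * (16 * δ) * T ^ p) := by
    have hpi' : ENNReal.ofReal Real.pi ≠ 0 := by simpa using hpi
    have e : X = ENNReal.ofReal (Real.pi * (1 - ‖u‖ ^ 2)) *
        (ENNReal.ofReal (1 / (1 - ‖u‖ ^ 2)) * ((ENNReal.ofReal Real.pi)⁻¹ * X)) := by
      rw [ENNReal.ofReal_mul hpi.le, one_div, ENNReal.ofReal_inv_of_pos h2]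
      have h5 : ENNReal.ofReal (1 - ‖u‖ ^ 2) ≠ 0 := by simpa using h2
      calc X = (ENNReal.ofReal Real.pi * (ENNReal.ofReal Real.pi)⁻¹) *
            (ENNReal.ofReal (1 - ‖u‖ ^ 2) * (ENNReal.ofReal (1 - ‖u‖ ^ 2))⁻¹) * X := by
            rw [ENNReal.mul_inv_cancel hpi' ENNReal.ofReal_ne_top,
              ENNReal.mul_inv_cancel h5 ENNReal.ofReal_ne_top, one_mul, one_mul]
        _ = _ := by ring
    rw [e]
    refine (mul_le_mul_right hbox _).trans ?_
    rw [← ENNReal.ofReal_mul (by positivity)]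
    refine ENNReal.ofReal_le_ofReal ?_
    gcongr
    rw [hun] at h4 ⊢
    linarith
  refine (lintegral_mono_set (ball_inter_subset_carlesonBox hξ hδ (by linarith))).trans ?_
  have hbD : carlesonBox u ⊆ unitDisk := (exists_carlesonBox_subset huD).choose_spec.2.trans
    inter_subset_right
  have hle' : ∫⁻ z in carlesonBox u, density f p (α + 1) z ≤ ENNReal.ofReal (2 ^ |α + 1|) * X := by
    rw [hX, ← lintegral_const_mul' _ _ ENNReal.ofReal_ne_top]
    refine lintegral_mono_ae ?_
    have : ∀ᵐ z ∂(volume.restrict unitDisk), z ∈ unitDisk :=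
      ae_restrict_mem isOpen_unitDisk.measurableSet
    filter_upwards [ae_mono (Measure.restrict_mono hbD le_rfl) this] with z hz
    exact density_le_tentNorm_integrand f hp _ hz
  refine hle'.trans ((mul_le_mul_right hXle _).trans (le_of_eq ?_))
  rw [← ENNReal.ofReal_mul (by positivity)]
  congr 1; ring

/-! ### Test functions -/

/-- The test function `(1 - |a|)^s / (1 - conj a z)^m`. -/
def testFunction (m : ℕ) (s : ℝ) (a z : ℂ) : ℂ :=
  ((1 - ‖a‖) ^ s : ℝ) * ((1 - (starRingEnd ℂ) a * z) ^ m)⁻¹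

lemma one_sub_norm_le_norm_one_sub {a z : ℂ} (hz : z ∈ unitDisk) :
    1 - ‖a‖ ≤ ‖1 - (starRingEnd ℂ) a * z‖ := by
  rw [mem_unitDisk] at hz
  have h1 := norm_sub_norm_le 1 ((starRingEnd ℂ) a * z)
  rw [norm_mul, RCLike.norm_conj, norm_one] at h1
  nlinarith [norm_nonneg a]

lemma one_sub_conj_mul_ne_zero {a z : ℂ} (ha : a ∈ unitDisk) (hz : z ∈ unitDisk) :
    1 - (starRingEnd ℂ) a * z ≠ 0 := by
  rw [mem_unitDisk] at ha
  rw [← norm_pos_iff]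
  linarith [one_sub_norm_le_norm_one_sub (a := a) hz]

lemma iteratedDeriv_testFunction (m : ℕ) (s : ℝ) {a : ℂ} (ha : a ∈ unitDisk) (k : ℕ) :
    ∀ z ∈ unitDisk, iteratedDeriv k (testFunction m s a) z =
      ((1 - ‖a‖) ^ s : ℝ) * (m.ascFactorial k * (starRingEnd ℂ) a ^ k *
        ((1 - (starRingEnd ℂ) a * z) ^ (m + k))⁻¹) := by
  induction k with
  | zero => intro z _; simp [testFunction]
  | succ k ih =>
    intro z hz
    have hne := one_sub_conj_mul_ne_zero ha hz
    have hd : HasDerivAt (fun w : ℂ => 1 - (starRingEnd ℂ) a * w) (-(starRingEnd ℂ) a) z := by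
      simpa using ((hasDerivAt_id z).const_mul ((starRingEnd ℂ) a)).const_sub 1
    have hd2 := (((hd.fun_pow (m + k)).fun_inv (pow_ne_zero _ hne)).const_mul
      (m.ascFactorial k * (starRingEnd ℂ) a ^ k : ℂ)).const_mul (((1 - ‖a‖) ^ s : ℝ) : ℂ)
    rw [iteratedDeriv_succ]
    have heq : iteratedDeriv k (testFunction m s a) =ᶠ[nhds z] fun w =>
        (((1 - ‖a‖) ^ s : ℝ) : ℂ) * (m.ascFactorial k * (starRingEnd ℂ) a ^ k *
          ((1 - (starRingEnd ℂ) a * w) ^ (m + k))⁻¹) := by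
      filter_upwards [isOpen_unitDisk.mem_nhds hz] with w hw using ih w hw
    rw [heq.deriv_eq, hd2.deriv, Nat.ascFactorial_succ]
    push_cast
    -- The power rule produces the natural exponent `m + k - 1`, which truncates at zero.
    rcases Nat.eq_zero_or_pos (m + k) with h0 | h0
    · simp [Nat.add_eq_zero_iff.1 h0]
    · obtain ⟨j, hj⟩ : ∃ j, m + k = j + 1 := ⟨m + k - 1, by omega⟩
      have hj' : (m : ℂ) + k = j + 1 := by exact_mod_cast hj
      rw [← add_assoc m k 1, hj, hj', Nat.add_sub_cancel]
      field_simp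
      ring

lemma testFunction_mem_holo (m : ℕ) (s : ℝ) {a : ℂ} (ha : a ∈ unitDisk) :
    testFunction m s a ∈ holo := by
  intro z hz
  have hne := pow_ne_zero m (one_sub_conj_mul_ne_zero ha hz)
  have hd : DifferentiableAt ℂ (fun w : ℂ => (1 - (starRingEnd ℂ) a * w) ^ m) z := by fun_prop
  exact ((hd.fun_inv hne).const_mul _).differentiableWithinAt

/-- At `z = a` the denominator is a power of `1 - ‖a‖ ^ 2 ≤ 2 * (1 - ‖a‖)`, costing `2 ^ (m + k)`;
the factor `‖a‖ ^ k` costs `2 ^ k` more and is why `a` is kept away from the origin. -/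
lemma le_norm_iteratedDeriv_testFunction {m : ℕ} (hm : 0 < m) (s : ℝ) {a : ℂ}
    (ha : a ∈ unitDisk) (ha' : 1 / 2 ≤ ‖a‖) (k : ℕ) :
    (1 / 2) ^ (m + 2 * k) * (1 - ‖a‖) ^ (s - m - k) ≤
      ‖iteratedDeriv k (testFunction m s a) a‖ := by
  obtain ⟨h1, h2, h3, h4⟩ := one_sub_norm_sq_bounds ha
  have hden : ‖1 - (starRingEnd ℂ) a * a‖ = 1 - ‖a‖ ^ 2 := by
    rw [← Complex.normSq_eq_conj_mul_self, Complex.normSq_eq_norm_sq, ← Complex.ofReal_one,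
      ← Complex.ofReal_sub, Complex.norm_real, Real.norm_of_nonneg h2.le]
  have hasc : (1 : ℝ) ≤ m.ascFactorial k := by
    obtain ⟨j, rfl⟩ : ∃ j, m = j + 1 := ⟨m - 1, by omega⟩
    exact_mod_cast Nat.ascFactorial_pos j k
  rw [iteratedDeriv_testFunction m s ha k a ha, norm_mul, norm_mul, norm_mul, norm_inv, norm_pow,
    norm_pow, hden, RCLike.norm_conj, Complex.norm_real, Real.norm_of_nonneg (by positivity),
    Complex.norm_natCast]
  have e : (1 - ‖a‖) ^ (s - m - k) = (1 - ‖a‖) ^ s * ((1 - ‖a‖) ^ (m + k))⁻¹ := by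
    rw [sub_sub, Real.rpow_sub h1, ← Nat.cast_add, Real.rpow_natCast, div_eq_mul_inv]
  have h5 : (1 / 2) ^ (m + k) * ((1 - ‖a‖) ^ (m + k))⁻¹ ≤ ((1 - ‖a‖ ^ 2) ^ (m + k))⁻¹ := by
    rw [one_div, inv_pow, ← mul_inv, ← mul_pow]
    gcongr
  calc (1 / 2) ^ (m + 2 * k) * (1 - ‖a‖) ^ (s - m - k)
      = (1 - ‖a‖) ^ s * (1 * (1 / 2) ^ k * ((1 / 2) ^ (m + k) * ((1 - ‖a‖) ^ (m + k))⁻¹)) := by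
        rw [e]; ring
    _ ≤ (1 - ‖a‖) ^ s * (m.ascFactorial k * ‖a‖ ^ k * ((1 - ‖a‖ ^ 2) ^ (m + k))⁻¹) := by
        gcongr

/-- A Forelli–Rudin type estimate. -/
lemma lintegral_one_sub_conj_mul_le {b N : ℝ} (hb : -1 < b) (hN : b + 2 < N) :
    ∃ K : ℝ, 0 < K ∧ ∀ a ∈ unitDisk,
      ∫⁻ z in unitDisk, ENNReal.ofReal (‖1 - (starRingEnd ℂ) a * z‖⁻¹ ^ N) *
        ENNReal.ofReal ((1 - ‖z‖) ^ b) ≤ ENNReal.ofReal (K * (1 - ‖a‖) ^ (b + 2 - N)) := by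
  have hpi := Real.pi_pos
  have hN0 : 0 < N := by linarith
  set W : ℝ := 2 * Real.pi / (b + 1) with hW
  have hWpos : 0 < W := div_pos (by linarith) (by linarith)
  have hM : 0 < N - (b + 2) := by linarith
  refine ⟨N * (W * 2 ^ (b + 2) / (N - (b + 2))), by positivity, fun a ha => ?_⟩
  obtain ⟨h1, -⟩ := one_sub_norm_sq_bounds ha
  set w : ℂ → ENNReal := fun z => ENNReal.ofReal ((1 - ‖z‖) ^ b) with hw
  have hwm : Measurable w := by fun_prop
  set φ : ℂ → ℝ := fun z => ‖1 - (starRingEnd ℂ) a * z‖⁻¹ with hφ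
  have hφm : Measurable φ := by fun_prop
  set μ : Measure ℂ := (volume.restrict unitDisk).withDensity w with hμ
  have e1 : ∫⁻ z in unitDisk, ENNReal.ofReal (φ z ^ N) * w z =
      ∫⁻ z, ENNReal.ofReal (φ z ^ N) ∂μ := by
    rw [hμ, lintegral_withDensity_eq_lintegral_mul _ hwm (by fun_prop)]
    simp only [Pi.mul_apply, mul_comm]
  obtain ⟨ξ, hξ, haξ⟩ := exists_norm_eq_one_norm_sub a ha
  -- Layer-cake estimate: the superlevel set at height `t` is empty for `t ≥ 1 / (1 - ‖a‖)`, and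
  -- otherwise lies within `2 / t` of the boundary point nearest `a`.
  have hlevel : ∀ t ∈ Ioi (0 : ℝ), μ {z | t < φ z} * ENNReal.ofReal (t ^ (N - 1)) ≤
      (Ioo 0 (1 / (1 - ‖a‖))).indicator (fun t => ENNReal.ofReal (W * 2 ^ (b + 2)) *
        ENNReal.ofReal (t ^ (N - (b + 2) - 1))) t := by
    intro t ht
    have ht0 : 0 < t := ht
    have hsm : MeasurableSet {z | t < φ z} := measurableSet_lt measurable_const hφm
    rw [hμ, withDensity_apply _ hsm, Measure.restrict_restrict hsm]
    have hsub : ∀ z ∈ {z | t < φ z} ∩ unitDisk, ‖1 - (starRingEnd ℂ) a * z‖ < 1 / t := by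
      rintro z ⟨hz1, hz⟩
      have hpos : 0 < ‖1 - (starRingEnd ℂ) a * z‖ := norm_pos_iff.2 (one_sub_conj_mul_ne_zero ha hz)
      rw [one_div, lt_inv_comm₀ hpos ht0]
      exact hz1
    by_cases htI : t ∈ Ioo 0 (1 / (1 - ‖a‖))
    · rw [indicator_of_mem htI]
      have hta : 1 - ‖a‖ < 1 / t := by
        rw [lt_div_iff₀ ht0, mul_comm, ← lt_div_iff₀ h1]; exact htI.2
      have hsub2 : {z | t < φ z} ∩ unitDisk ⊆ ball ξ (2 * (1 / t)) ∩ unitDisk := by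
        intro z hz
        refine ⟨?_, hz.2⟩
        have h3 := hsub z hz
        have hzn := mem_unitDisk.1 hz.2
        have h4 : ‖z - ξ‖ = ‖1 - (starRingEnd ℂ) ξ * z‖ := by
          have : (starRingEnd ℂ) ξ * ξ = 1 := by
            rw [← Complex.normSq_eq_conj_mul_self, Complex.normSq_eq_norm_sq, hξ]; simp
          rw [show 1 - (starRingEnd ℂ) ξ * z = (starRingEnd ℂ) ξ * (ξ - z) by rw [mul_sub, this],
            norm_mul, RCLike.norm_conj, hξ, one_mul, norm_sub_rev]
        have h5 : ‖((starRingEnd ℂ) a - (starRingEnd ℂ) ξ) * z‖ ≤ 1 - ‖a‖ := by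
          rw [← map_sub, norm_mul, RCLike.norm_conj, haξ]
          nlinarith
        have h6 : 1 - (starRingEnd ℂ) ξ * z = (1 - (starRingEnd ℂ) a * z) +
            ((starRingEnd ℂ) a - (starRingEnd ℂ) ξ) * z := by ring
        have h7 := norm_add_le (1 - (starRingEnd ℂ) a * z)
          (((starRingEnd ℂ) a - (starRingEnd ℂ) ξ) * z)
        rw [mem_ball, dist_eq_norm, h4, h6]
        linarith
      refine (mul_le_mul_left ((lintegral_mono_set hsub2).trans
        (weight_ball_le hb hξ (by positivity : 0 < 2 * (1 / t)))) _).trans (le_of_eq ?_)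
      rw [← ENNReal.ofReal_mul (by positivity), ← ENNReal.ofReal_mul (by positivity),
        Real.mul_rpow (by norm_num) (by positivity), one_div, Real.inv_rpow ht0.le,
        ← Real.rpow_neg ht0.le, show N - (b + 2) - 1 = -(b + 2) + (N - 1) by ring,
        Real.rpow_add ht0]
      congr 1; ring
    · have hempty : {z | t < φ z} ∩ unitDisk = ∅ := by
        rw [eq_empty_iff_forall_notMem]
        intro z hz
        have h3 := hsub z hz
        have h4 := one_sub_norm_le_norm_one_sub (a := a) hz.2
        refine htI ⟨ht0, ?_⟩
        rw [lt_div_iff₀ h1, mul_comm, ← lt_div_iff₀ ht0]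
        linarith
      rw [hempty]; simp
  rw [e1, lintegral_rpow_eq_lintegral_meas_lt_mul μ
    (Filter.Eventually.of_forall fun z => by simp only [hφ, Pi.zero_apply]; positivity)
    hφm.aemeasurable hN0]
  refine (mul_le_mul_right ((setLIntegral_mono' measurableSet_Ioi hlevel).trans
    (setLIntegral_le_lintegral _ _)) _).trans (le_of_eq ?_)
  rw [lintegral_indicator measurableSet_Ioo, lintegral_const_mul' _ _ ENNReal.ofReal_ne_top,
    setLIntegral_Ioo_rpow (by linarith) (by positivity), sub_add_cancel,
    ← ENNReal.ofReal_mul (by positivity), ← ENNReal.ofReal_mul (by positivity)]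
  congr 1
  rw [one_div, Real.inv_rpow h1.le, ← Real.rpow_neg h1.le, neg_sub]
  ring

/-- For `δ ≤ 1 - ‖a‖` the denominator is at least `1 - ‖a‖` and the mass of the weight near `ξ`
suffices. For larger `δ` the integral over the whole disk is already of order `1 - ‖a‖ < δ`; the
condition on `m` makes the Forelli–Rudin estimate applicable. -/
lemma carlesonBound_testFunction {p α : ℝ} (hp : 0 < p) (hα : -2 < α) {m : ℕ}
    (hm : α + 3 < m * p) : ∃ C : ℝ, 0 < C ∧ ∀ a ∈ unitDisk,
      CarlesonBound (testFunction m (m - (α + 2) / p) a) p (α + 1) C := by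
  have hpi := Real.pi_pos
  obtain ⟨K, hK, h⟩ := lintegral_one_sub_conj_mul_le (b := α + 1) (N := m * p) (by linarith)
    (by linarith)
  set W : ℝ := 2 * Real.pi / (α + 1 + 1) with hW
  have hWpos : 0 < W := div_pos (by linarith) (by linarith)
  refine ⟨W + K, by positivity, fun a ha ξ hξ δ hδ => ?_⟩
  obtain ⟨h1, -⟩ := one_sub_norm_sq_bounds ha
  have hdens : ∀ z ∈ unitDisk, density (testFunction m (m - (α + 2) / p) a) p (α + 1) z =
      ENNReal.ofReal ((1 - ‖a‖) ^ (m * p - (α + 2))) *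
        (ENNReal.ofReal (‖1 - (starRingEnd ℂ) a * z‖⁻¹ ^ (m * p)) *
          ENNReal.ofReal ((1 - ‖z‖) ^ (α + 1))) := by
    intro z hz
    rw [← ENNReal.ofReal_mul (by positivity), ← ENNReal.ofReal_mul (by positivity), density,
      testFunction, norm_mul, norm_inv, norm_pow, Complex.norm_real,
      Real.norm_of_nonneg (by positivity), Real.mul_rpow (by positivity) (by positivity),
      ← Real.rpow_mul h1.le, Real.rpow_mul (inv_nonneg.2 (norm_nonneg _)), Real.rpow_natCast, inv_pow, ← mul_assoc]
    congr 4
    field_simp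
  have hm' : MeasurableSet (ball ξ δ ∩ unitDisk) := measurableSet_ball.inter measurableSet_ball
  rw [setLIntegral_congr_fun hm' fun z hz => hdens z hz.2,
    lintegral_const_mul' _ _ ENNReal.ofReal_ne_top]
  rcases le_or_gt δ (1 - ‖a‖) with hcase | hcase
  · have h2 : ∀ z ∈ ball ξ δ ∩ unitDisk, ENNReal.ofReal (‖1 - (starRingEnd ℂ) a * z‖⁻¹ ^ (m * p)) *
        ENNReal.ofReal ((1 - ‖z‖) ^ (α + 1)) ≤ ENNReal.ofReal ((1 - ‖a‖)⁻¹ ^ (m * p)) *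
          ENNReal.ofReal ((1 - ‖z‖) ^ (α + 1)) := by
      rintro z ⟨-, hz⟩
      have := one_sub_norm_le_norm_one_sub (a := a) hz
      gcongr
    refine (mul_le_mul_right (setLIntegral_mono' hm' h2) _).trans ?_
    rw [lintegral_const_mul' _ _ ENNReal.ofReal_ne_top]
    refine (mul_le_mul_right (mul_le_mul_right (weight_ball_le (by linarith) hξ hδ) _) _).trans ?_
    rw [← ENNReal.ofReal_mul (by positivity), ← ENNReal.ofReal_mul (by positivity)]
    refine ENNReal.ofReal_le_ofReal ?_
    have h3 : (1 - ‖a‖) ^ (m * p - (α + 2)) * (1 - ‖a‖)⁻¹ ^ (m * p) = (1 - ‖a‖) ^ (-(α + 2)) := by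
      rw [Real.inv_rpow h1.le, ← Real.rpow_neg h1.le, ← Real.rpow_add h1]
      congr 1; ring
    have h4 : (1 - ‖a‖) ^ (-(α + 2)) ≤ δ ^ (-(α + 2)) :=
      Real.rpow_le_rpow_of_nonpos hδ hcase (by linarith)
    have h5 : δ ^ (-(α + 2)) * δ ^ (α + 1 + 2) = δ := by
      rw [← Real.rpow_add hδ, show -(α + 2) + (α + 1 + 2) = 1 by ring, Real.rpow_one]
    calc _ = W * ((1 - ‖a‖) ^ (-(α + 2)) * δ ^ (α + 1 + 2)) := by rw [← h3, hW]; ring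
      _ ≤ W * (δ ^ (-(α + 2)) * δ ^ (α + 1 + 2)) := by gcongr
      _ ≤ _ := by rw [h5]; nlinarith
  · refine (mul_le_mul_right ((lintegral_mono_set inter_subset_right).trans (h a ha)) _).trans ?_
    rw [← ENNReal.ofReal_mul (by positivity)]
    refine ENNReal.ofReal_le_ofReal ?_
    rw [mul_left_comm, ← Real.rpow_add h1,
      show m * p - (α + 2) + (α + 1 + 2 - m * p) = 1 by ring, Real.rpow_one]
    nlinarith

/-! ### Multiplication, and the two directions of the theorem -/

lemma CarlesonBound.mono {f : ℂ → ℂ} {p a C C' : ℝ} (h : CarlesonBound f p a C) (hC : C ≤ C') :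
    CarlesonBound f p a C' := fun ξ hξ δ hδ =>
  (h ξ hξ δ hδ).trans (ENNReal.ofReal_le_ofReal (mul_le_mul_of_nonneg_right hC hδ.le))

/-- Multiplication by a function of controlled growth raises the exponent of a Carleson bound. -/
lemma CarlesonBound.mul {p q : ℝ} (hp : 0 < p) (hpq : p ≤ q) (κ e : ℝ) :
    ∃ K : ℝ, 0 < K ∧ ∀ f ∈ holo, ∀ C : ℝ, 0 ≤ C → CarlesonBound f p (κ * p - 1) C →
      ∀ (γ : ℂ → ℂ) (M : ℝ), (∀ z ∈ unitDisk, ‖γ z‖ * (1 - ‖z‖) ^ e ≤ M) →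
      CarlesonBound (fun z => f z * γ z) q (e * q + κ * q - 1)
        (M ^ q * (K * C) ^ ((q - p) / p) * C) := by
  obtain ⟨K, hK, hpt⟩ := CarlesonBound.pointwise hp (κ * p - 1)
  have hq : 0 < q := by linarith
  refine ⟨K, hK, fun f hf C hC hb γ M hM ξ hξ δ hδ => ?_⟩
  have hM0 : 0 ≤ M := le_trans (by simp) (hM 0 (by simp [mem_unitDisk]))
  have hpq' : 0 ≤ (q - p) / p := div_nonneg (by linarith) hp.le
  -- Write `|f|^q = |f|^p |f|^(q-p)`. The pointwise bound `|f|^p (1 - |z|)^(κ p) ≤ K C`, raised to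
  -- the power `(q - p) / p ≥ 0`, absorbs the second factor.
  have hle : ∀ z ∈ ball ξ δ ∩ unitDisk, density (fun z => f z * γ z) q (e * q + κ * q - 1) z ≤
      ENNReal.ofReal (M ^ q * (K * C) ^ ((q - p) / p)) * density f p (κ * p - 1) z := by
    rintro z ⟨-, hz⟩
    obtain ⟨h1, -⟩ := one_sub_norm_sq_bounds hz
    have h2 := hpt f hf C hC hb z hz
    rw [sub_add_cancel] at h2
    have h3 : (‖γ z‖ * (1 - ‖z‖) ^ e) ^ q ≤ M ^ q :=
      Real.rpow_le_rpow (by positivity) (hM z hz) hq.le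
    have h4 : (‖f z‖ ^ p * (1 - ‖z‖) ^ (κ * p)) ^ ((q - p) / p) ≤ (K * C) ^ ((q - p) / p) :=
      Real.rpow_le_rpow (by positivity) h2 hpq'
    rw [density, density, ← ENNReal.ofReal_mul (by positivity)]
    refine ENNReal.ofReal_le_ofReal ?_
    have e1 : ‖f z‖ ^ q = ‖f z‖ ^ p * ‖f z‖ ^ (q - p) := by
      rw [← Real.rpow_add_of_nonneg (norm_nonneg _) hp.le (by linarith), add_sub_cancel]
    have e2 : (1 - ‖z‖) ^ (e * q + κ * q - 1) =
        (1 - ‖z‖) ^ (e * q) * ((1 - ‖z‖) ^ (κ * p - 1) * (1 - ‖z‖) ^ (κ * (q - p))) := by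
      rw [← Real.rpow_add h1, ← Real.rpow_add h1]; congr 1; ring
    calc ‖f z * γ z‖ ^ q * (1 - ‖z‖) ^ (e * q + κ * q - 1)
        = (‖γ z‖ * (1 - ‖z‖) ^ e) ^ q * (‖f z‖ ^ p * (1 - ‖z‖) ^ (κ * p)) ^ ((q - p) / p) *
            (‖f z‖ ^ p * (1 - ‖z‖) ^ (κ * p - 1)) := by
          rw [norm_mul, Real.mul_rpow (norm_nonneg _) (norm_nonneg _), e1, e2,
            Real.mul_rpow (norm_nonneg _) (by positivity), ← Real.rpow_mul h1.le,
            Real.mul_rpow (by positivity) (by positivity), ← Real.rpow_mul h1.le,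
            ← Real.rpow_mul (norm_nonneg _), mul_div_cancel₀ _ hp.ne',
            show κ * p * ((q - p) / p) = κ * (q - p) by field_simp]
          ring
      _ ≤ _ := by gcongr
  refine (setLIntegral_mono' (measurableSet_ball.inter measurableSet_ball) hle).trans ?_
  rw [lintegral_const_mul' _ _ ENNReal.ofReal_ne_top]
  refine (mul_le_mul_right (hb ξ hξ δ hδ) _).trans (le_of_eq ?_)
  rw [← ENNReal.ofReal_mul (by positivity), ← mul_assoc]

lemma mul_iteratedDeriv_mem_holo {f g : ℂ → ℂ} (hf : f ∈ holo) (hg : g ∈ holo) (n k : ℕ) :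
    (fun z => iteratedDeriv k f z * iteratedDeriv (n - k) g z) ∈ holo :=
  DifferentiableOn.mul (iteratedDeriv_mem_holo hf k) (iteratedDeriv_mem_holo hg (n - k))

lemma genIntegrationOp_mem_holo {f g : ℂ → ℂ} (hf : f ∈ holo) (hg : g ∈ holo) (n k : ℕ) :
    genIntegrationOp g n k f ∈ holo :=
  iterate_integrationOp_mem_holo (mul_iteratedDeriv_mem_holo hf hg n k) n

lemma mem_analyticTentSpace {ζ p α : ℝ} {f : ℂ → ℂ} (hf : f ∈ holo)
    (h : tentNorm ζ p α f < ⊤) : f ∈ analyticTentSpace ζ p α :=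
  ⟨⟨(continuousOn_iff_continuous_domRestrict.1 (DifferentiableOn.continuousOn hf)).measurable, h⟩, hf⟩

lemma tentNorm_genIntegrationOp_le {ζ p q α β : ℝ} (hζ : 1 / 2 < ζ) (hp : 0 < p) (hpq : p ≤ q)
    (hβ : -2 < β) {g : ℂ → ℂ} (hg : g ∈ holo) (n k : ℕ) {M : ℝ}
    (hM : ∀ z ∈ unitDisk, ‖iteratedDeriv (n - k) g z‖ *
      (1 - ‖z‖) ^ ((n : ℝ) - k + (β + 2) / q - (α + 2) / p) ≤ M) :
    ∃ A : ℝ, 0 ≤ A ∧ ∀ f ∈ holo, tentNorm ζ p α f < ⊤ →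
      tentNorm ζ q β (genIntegrationOp g n k f) ≤
        ENNReal.ofReal (A * (tentNorm ζ p α f).toReal) := by
  have hq : 0 < q := by linarith
  set e : ℝ := (n : ℝ) - k + (β + 2) / q - (α + 2) / p with he
  -- The growth order of the `k`-th derivative. It satisfies `κ * p - 1 = α + 1 + k * p` and `e * q
  -- + κ * q - 1 = β + 1 + n * q`, which links the bounds below.
  set κ : ℝ := k + (α + 2) / p with hκ
  have hM0 : 0 ≤ M := le_trans (by simp) (hM 0 (by simp [mem_unitDisk]))
  obtain ⟨K₁, hK₁, H₁⟩ := carlesonBound_of_tentNorm hζ hp α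
  obtain ⟨K₂, hK₂, H₂⟩ := CarlesonBound.iteratedDeriv hp (α + 1) k
  obtain ⟨K₃, hK₃, H₃⟩ := CarlesonBound.mul hp hpq κ e
  obtain ⟨K₄, hK₄, H₄⟩ := CarlesonBound.iterate_integrationOp hq (a := β + 1) (by linarith) n
  obtain ⟨K₅, hK₅, H₅⟩ := CarlesonBound.tentNorm_le hq ζ β
  set Y : ℝ := K₂ * K₁ with hY
  have hY0 : 0 < Y := by positivity
  refine ⟨(K₅ * (K₄ * (M ^ q * (K₃ * Y) ^ ((q - p) / p) * Y))) ^ (1 / q), by positivity,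
    fun f hf hfin => ?_⟩
  set T : ℝ := (tentNorm ζ p α f).toReal with hT
  have hT0 : 0 ≤ T := ENNReal.toReal_nonneg
  have c1 := H₂ f hf _ (by positivity) (H₁ f hf hfin)
  rw [← mul_assoc, ← hY, show α + 1 + k * p = κ * p - 1 by rw [hκ]; field_simp; ring] at c1
  have c2 := H₃ _ (iteratedDeriv_mem_holo hf k) _ (by positivity) c1 _ M hM
  rw [show e * q + κ * q - 1 = β + 1 + n * q by rw [hκ, he]; field_simp; ring] at c2
  have c3 := H₄ _ (mul_iteratedDeriv_mem_holo hf hg n k) _ (by positivity) c2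
  refine (H₅ _ _ (by positivity) c3).trans (ENNReal.ofReal_le_ofReal (le_of_eq ?_))
  -- The powers of `T` combine as `(q - p) + p = q`, so the final `q`-th root is linear in the norm.
  have e1 : (K₃ * (Y * T ^ p)) ^ ((q - p) / p) = (K₃ * Y) ^ ((q - p) / p) * T ^ (q - p) := by
    rw [← mul_assoc, Real.mul_rpow (by positivity) (by positivity), ← Real.rpow_mul hT0,
      mul_div_cancel₀ _ hp.ne']
  have e2 : T ^ (q - p) * T ^ p = T ^ q := by
    rw [← Real.rpow_add_of_nonneg hT0 (by linarith) hp.le, sub_add_cancel]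
  have e3 : K₅ * (K₄ * (M ^ q * (K₃ * (Y * T ^ p)) ^ ((q - p) / p) * (Y * T ^ p))) =
      K₅ * (K₄ * (M ^ q * (K₃ * Y) ^ ((q - p) / p) * Y)) * T ^ q := by
    rw [e1, ← e2]; ring
  rw [e3, Real.mul_rpow (by positivity) (by positivity), ← Real.rpow_mul hT0,
    mul_one_div_cancel hq.ne', Real.rpow_one]

lemma iteratedDeriv_pointwise {ζ q : ℝ} (hζ : 1 / 2 < ζ) (hq : 0 < q) (β : ℝ) (n : ℕ) :
    ∃ K : ℝ, 0 < K ∧ ∀ F ∈ holo, ∀ A : ℝ, 0 ≤ A → tentNorm ζ q β F ≤ ENNReal.ofReal A →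
      ∀ z ∈ unitDisk, ‖iteratedDeriv n F z‖ ^ q * (1 - ‖z‖) ^ (β + 2 + n * q) ≤ K * A ^ q := by
  obtain ⟨K₁, hK₁, H₁⟩ := carlesonBound_of_tentNorm hζ hq β
  obtain ⟨K₂, hK₂, H₂⟩ := CarlesonBound.iteratedDeriv hq (β + 1) n
  obtain ⟨K₃, hK₃, H₃⟩ := CarlesonBound.pointwise hq (β + 1 + n * q)
  refine ⟨K₃ * (K₂ * K₁), by positivity, fun F hF A hA hle z hz => ?_⟩
  have hT : (tentNorm ζ q β F).toReal ≤ A := ENNReal.toReal_le_of_le_ofReal hA hle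
  have c1 := (H₁ F hF (hle.trans_lt ENNReal.ofReal_lt_top)).mono
    (show _ ≤ K₁ * A ^ q by gcongr)
  have c2 := H₃ _ (iteratedDeriv_mem_holo hF n) _ (by positivity) (H₂ F hF _ (by positivity) c1) z hz
  rw [show β + 1 + n * q + 1 = β + 2 + n * q by ring] at c2
  linarith

/-- Applying the operator to the test function at `a` and differentiating `n` times at `a` leaves
the product of the derivative of the test function, bounded below, with the derivative of `g`. -/
lemma growth_of_isBoundedOp {ζ p q α β : ℝ} (hζ : 1 / 2 < ζ) (hp : 0 < p) (hpq : p ≤ q)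
    (hα : -2 < α) {g : ℂ → ℂ} (hg : g ∈ holo) {n k : ℕ}
    (h : IsBoundedOp ζ p α q β (genIntegrationOp g n k)) :
    ∃ B : ℝ, ∀ a ∈ unitDisk, 1 / 2 ≤ ‖a‖ → ‖iteratedDeriv (n - k) g a‖ *
      (1 - ‖a‖) ^ ((n : ℝ) - k + (β + 2) / q - (α + 2) / p) ≤ B := by
  have hq : 0 < q := by linarith
  obtain ⟨-, C, hC⟩ := h
  obtain ⟨m, hm⟩ := exists_nat_gt ((α + 3) / p)
  rw [div_lt_iff₀ hp] at hm
  have hm0 : 0 < m := by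
    rcases Nat.eq_zero_or_pos m with rfl | h0
    · norm_num at hm; linarith
    · exact h0
  obtain ⟨C₀, hC₀, H₀⟩ := carlesonBound_testFunction hp hα hm
  obtain ⟨K₁, hK₁, H₁⟩ := CarlesonBound.tentNorm_le hp ζ α
  obtain ⟨K₂, hK₂, H₂⟩ := iteratedDeriv_pointwise hζ hq β n
  set s : ℝ := m - (α + 2) / p with hs
  set A₀ : ℝ := (K₁ * C₀) ^ (1 / p) with hA₀
  set B : ℝ := K₂ * (C * A₀) ^ q with hB
  have hA₀pos : 0 < A₀ := by positivity
  set c : ℝ := (1 / 2) ^ (m + 2 * k) with hc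
  have hcpos : 0 < c := by positivity
  refine ⟨B ^ (1 / q) / c, fun a ha ha' => ?_⟩
  obtain ⟨h1, -⟩ := one_sub_norm_sq_bounds ha
  have hholo := testFunction_mem_holo m s ha
  have hn : tentNorm ζ p α (testFunction m s a) ≤ ENNReal.ofReal A₀ := H₁ _ _ hC₀.le (H₀ a ha)
  have hTn := (hC _ (mem_analyticTentSpace hholo (hn.trans_lt ENNReal.ofReal_lt_top))).trans
    (mul_le_mul_right hn _)
  rw [← ENNReal.ofReal_coe_nnreal, ← ENNReal.ofReal_mul (by positivity)] at hTn
  have h2 := H₂ _ (genIntegrationOp_mem_holo hholo hg n k) _ (by positivity) hTn a ha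
  rw [genIntegrationOp, iteratedDeriv_iterate_integrationOp
    (mul_iteratedDeriv_mem_holo hholo hg n k) n ha, norm_mul, ← hB] at h2
  have h3 := le_norm_iteratedDeriv_testFunction hm0 s ha ha' k
  rw [le_div_iff₀ hcpos, one_div, Real.le_rpow_inv_iff_of_pos (by positivity) (by positivity) hq]
  refine le_trans (le_of_eq ?_) ((mul_le_mul_of_nonneg_right (Real.rpow_le_rpow (by positivity)
    (mul_le_mul_of_nonneg_right h3 (norm_nonneg _)) hq.le) (by positivity)).trans h2)
  rw [← hc, show s - m - k = -((α + 2) / p + k) by rw [hs]; ring,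
    show β + 2 + n * q = (n + (β + 2) / q) * q by field_simp; ring,
    Real.rpow_mul h1.le, ← Real.mul_rpow (by positivity) (by positivity),
    show (n : ℝ) - k + (β + 2) / q - (α + 2) / p =
      -((α + 2) / p + k) + (n + (β + 2) / q) by ring, Real.rpow_add h1]
  congr 1; ring

end AnalyticTent

end

open AnalyticTent in
theorem theorem3p1 (ζ : ℝ) (hζ : 1 / 2 < ζ) (p q α β : ℝ) (hp : 0 < p) (hpq : p ≤ q)
    (hα : -2 < α) (hβ : -2 < β) (g : ℂ → ℂ) (hg : g ∈ AnalyticTent.holo)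
    (n k : ℕ) (hkn : k < n) :
    AnalyticTent.IsBoundedOp ζ p α q β (AnalyticTent.genIntegrationOp g n k) ↔
      (⨆ z ∈ AnalyticTent.unitDisk,
        ENNReal.ofReal (‖iteratedDeriv (n - k) g z‖ *
          (1 - ‖z‖ ^ 2) ^ ((n : ℝ) - (k : ℝ) + (β + 2) / q - (α + 2) / p))) < ⊤ := by
  set e : ℝ := (n : ℝ) - (k : ℝ) + (β + 2) / q - (α + 2) / p with he
  constructor
  · intro h
    obtain ⟨B, hB⟩ := growth_of_isBoundedOp hζ hp hpq hα hg h
    -- The test functions only reach `‖z‖ ≥ 1 / 2`; on the inner disk the quantity is bounded by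
    -- compactness.
    have hsub : Metric.closedBall (0 : ℂ) (1 / 2) ⊆ unitDisk :=
      Metric.closedBall_subset_ball (by norm_num)
    have hcont : ContinuousOn (fun z => ‖iteratedDeriv (n - k) g z‖ * (1 - ‖z‖ ^ 2) ^ e)
        (Metric.closedBall 0 (1 / 2)) := by
      refine ContinuousOn.mul
        ((DifferentiableOn.continuousOn (iteratedDeriv_mem_holo hg (n - k))).mono hsub).norm ?_
      exact ContinuousOn.rpow_const (by fun_prop)
        fun z hz => Or.inl (one_sub_norm_sq_bounds (hsub hz)).2.1.ne'
    obtain ⟨B', hB'⟩ := (isCompact_closedBall (0 : ℂ) (1 / 2)).bddAbove_image hcont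
    refine lt_of_le_of_lt (iSup₂_le fun z hz => ENNReal.ofReal_le_ofReal
      (?_ : _ ≤ max (2 ^ |e| * B) B')) ENNReal.ofReal_lt_top
    rcases le_or_gt (1 / 2) ‖z‖ with hcase | hcase
    · refine le_trans ?_ (le_max_left _ _)
      refine le_trans ?_ (mul_le_mul_of_nonneg_left (hB z hz hcase) (by positivity))
      rw [mul_left_comm]
      exact mul_le_mul_of_nonneg_left (one_sub_norm_sq_rpow_le e hz) (norm_nonneg _)
    · refine le_trans ?_ (le_max_right _ _)
      exact hB' (Set.mem_image_of_mem _ (mem_closedBall_zero_iff.2 hcase.le))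
  · intro h
    set S := ⨆ z ∈ unitDisk, ENNReal.ofReal (‖iteratedDeriv (n - k) g z‖ * (1 - ‖z‖ ^ 2) ^ e)
      with hS
    have hM : ∀ z ∈ unitDisk, ‖iteratedDeriv (n - k) g z‖ * (1 - ‖z‖) ^ e ≤
        2 ^ |e| * S.toReal := by
      intro z hz
      have h1 : ‖iteratedDeriv (n - k) g z‖ * (1 - ‖z‖ ^ 2) ^ e ≤ S.toReal := by
        rw [← ENNReal.ofReal_le_iff_le_toReal h.ne, hS]
        exact le_iSup₂_of_le z hz le_rfl
      refine le_trans ?_ (mul_le_mul_of_nonneg_left h1 (by positivity))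
      rw [mul_left_comm]
      exact mul_le_mul_of_nonneg_left (one_sub_norm_rpow_le e hz) (norm_nonneg _)
    obtain ⟨A, hA, H⟩ := tentNorm_genIntegrationOp_le hζ hp hpq hβ hg n k hM
    refine ⟨fun f hf => mem_analyticTentSpace (genIntegrationOp_mem_holo hf.2 hg n k)
      ((H f hf.2 hf.1.2).trans_lt ENNReal.ofReal_lt_top), A.toNNReal, fun f hf => ?_⟩
    refine (H f hf.2 hf.1.2).trans_eq ?_
    rw [ENNReal.ofReal_mul hA, ENNReal.ofReal_toReal hf.1.2.ne]
    rfl
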